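/- **Setting.** Let $A\in\mathbb R^{n\times n}$, $B\in\mathbb R^{n\times m}$, $F\in\mathbb R^{n\times k}$, $\theta\in\mathbb R^k$, $K\in\mathbb R^{m\times n}$, and let $Q\in\mathbb R^{n\times n}$, $R\in\mathbb R^{m\times m}$ be symmetric positive definite. Assume that the columns of $B$ are linearly independent and that $A+BK$ is a Schur matrix (all its eigenvalues have modulus less than $1$). Put $L=I-A-BK$ and $E=(L^{-1})^\top L^{-1}$. Consider two Markov decision processes $M_0,M_1$ with state $x_t\in\mathbb R^n$, control $u_t\in\mathbb R^m$, reward $r(x,u)=-x^\top x$ and dynamics $$M_0:\ x_{t+1}=Ax_t+Bu_t+w_t,\qquad M_1:\ x_{t+1}=Ax_t+Bu_t+F\theta+w_t,\qquad w_t\ \text{i.i.d.}\ \mathcal N(0,Q).$$ For $\alpha_0,\alpha_1\in\mathbb R^m$ let $\pi_i$ be the randomized policy $u_t=Kx_t+\beta^i_t$ with $\beta_t^i$ i.i.d. $\mathcal N(\alpha_i,R)$, independent of the process noise. The system follows $(M_0,\pi_0)$ before an unknown change time $\nu\ge1$, in its stationary regime, and $(M_1,\pi_1)$ from $\nu$ on.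 Let $\mathbb P_\nu$ be the resulting law of the observations $Y_t=(x_t,u_t)$, $t\ge0$: given the past, $Y_t$ has the transition density $f_0(\cdot\,|\,Y_{t-1})$ of $(M_0,\pi_0)$ if $1\le t<\nu$, and $f_1(\cdot\,|\,Y_{t-1})$ of $(M_1,\pi_1)$ if $t\ge\nu$. Let $V_{M_i}^{\pi_i}=\lim_{N\to\infty}\mathbb E_{M_i}^{\pi_i}\big[\frac1N\sum_{t<N}r(x_t,u_t)\big]$ (from any initial state), and let $I_F$ be the inverse of the privacy level of $(Y_t)$, i.e. the constant $I$ such that, with $Z_t=\ln\frac{f_1(Y_t|Y_{t-1})}{f_0(Y_t|Y_{t-1})}$, (i) $\frac1n\sum_{t=\nu}^{\nu+n}Z_t\to I$ $\mathbb P_\nu$-almost surely for every $\nu\ge1$, and (ii) for every $\delta>0$, as $n\to\infty$, $$\sup_{\nu\ge1}\operatorname{ess\,sup}\ \mathbb P_\nu\Big(\max_{t\le n}\sum_{i=\nu}^{\nu+t}Z_i>I(1+\delta)n\ \Big|\ Y_0,\dots,Y_{\nu-1}\Big)\to0 .$$ For $\rho\in[0,1]$, $\lambda\ge0$, the utility–privacy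 function is $V_F(\rho,\lambda,\alpha_0,\alpha_1)=\rho V_{M_1}^{\pi_1}+(1-\rho)V_{M_0}^{\pi_0}-\lambda I_F$. **Claim.** The matrix $L$ is invertible. The Lyapunov equation $\Sigma=(A+BK)\Sigma(A+BK)^\top+Q+BRB^\top$ has exactly one solution $\Sigma$, and it is positive definite. For all $\rho\in[0,1]$, $\lambda\ge0$ and $\alpha_0,\alpha_1\in\mathbb R^m$, all the limits above exist, and $$V_F(\rho,\lambda,\alpha_0,\alpha_1)=-(1-\rho)\alpha_0^\top B^\top EB\alpha_0-\mathrm{Tr}(\Sigma)-\rho(B\alpha_1+F\theta)^\top E(B\alpha_1+F\theta)-\lambda\,\frac{c_\theta+(\alpha_1-\alpha_0)^\top R^{-1}(\alpha_1-\alpha_0)}2,$$ where $c_\theta=\theta^\top F^\top Q^{-1}F\theta$. For all $\rho\in[0,1]$ and $\lambda>0$, the function $(\alpha_0,\alpha_1)\mapsto V_F(\rho,\lambda,\alpha_0,\alpha_1)$ on $\mathbb R^m\times\mathbb R^m$ has exactly one maximizer, namely $$\alpha_0^\star(\rho,\lambda)=-\rho\big(B^\top T(\rho,\lambda)B\big)^{-1}B^\top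 EF\theta,\qquad \alpha_1^\star(\rho,\lambda)=\Big(2\tfrac{1-\rho}{\lambda}RB^\top EB+I\Big)\alpha_0^\star(\rho,\lambda),$$ where $T(\rho,\lambda)=\big(I+\frac{2(1-\rho)\rho}{\lambda}EBRB^\top\big)E$ and $B^\top T(\rho,\lambda)B$ is invertible. For every $\lambda>0$, the function $\alpha_1\mapsto V_F(1,\lambda,0,\alpha_1)$ (that is, $\rho=1$ and $\alpha_0=0$) has exactly one maximizer, namely $$\alpha_1^\star(\lambda)=-\big(RB^\top EB+\tfrac\lambda2I\big)^{-1}RB^\top EF\theta,$$ where $RB^\top EB+\frac\lambda2I$ is invertible. -/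

import Mathlib

open MeasureTheory ProbabilityTheory Filter Topology Matrix
open scoped MatrixOrder

/-! ### Markov decision processes on general measurable spaces -/

/-- A Markov decision process `(𝓧, 𝓤, P, r)`. -/
structure MDP (𝓧 𝓤 : Type*) [MeasurableSpace 𝓧] [MeasurableSpace 𝓤] where
  /-- the transition probabilities `P(· | x, u)` -/
  trans : Kernel (𝓧 × 𝓤) 𝓧
  /-- they are probabilities -/
  isMarkov : IsMarkovKernel trans
  /-- the reward `r(x, u)` -/
  reward : 𝓧 × 𝓤 → ℝ

instance {𝓧 𝓤 : Type*} [MeasurableSpace 𝓧] [MeasurableSpace 𝓤] (M : MDP 𝓧 𝓤) :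
    IsMarkovKernel M.trans := M.isMarkov

section MarkovChains

variable {𝓨 : Type*} [MeasurableSpace 𝓨]

/-- The law on `ℕ → 𝓨` of a (time-inhomogeneous) Markov chain `Y₀, Y₁, …` with initial law `μ`, in
which `κ t` is the conditional law of `Y_{t+1}` given `Y_t`. -/
noncomputable def markovLaw (μ : Measure 𝓨) [IsProbabilityMeasure μ] (κ : ℕ → Kernel 𝓨 𝓨)
    [∀ t, IsMarkovKernel (κ t)] : Measure (ℕ → 𝓨) :=
  Kernel.trajMeasure (X := fun _ ↦ 𝓨) μ
    (fun t ↦ (κ t).comap (fun h : (Π _ : Finset.Iic t, 𝓨) ↦ h ⟨t, Finset.mem_Iic.2 le_rfl⟩)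
      (measurable_pi_apply _))

/-- Conditional laws with a change at time `ν`: given the past, `Y_{t+1}` has conditional law `κ₀`
if `t + 1 < ν` and `κ₁` if `t + 1 ≥ ν`. -/
noncomputable def changeKernel (κ₀ κ₁ : Kernel 𝓨 𝓨) (ν t : ℕ) : Kernel 𝓨 𝓨 :=
  if t + 1 < ν then κ₀ else κ₁

instance (κ₀ κ₁ : Kernel 𝓨 𝓨) [IsMarkovKernel κ₀] [IsMarkovKernel κ₁] (ν t : ℕ) :
    IsMarkovKernel (changeKernel κ₀ κ₁ ν t) := by
  unfold changeKernel
  split_ifs <;> infer_instance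

/-- The law `ℙ_ν` of the observations `Y₀, Y₁, …` when the change occurs at time `ν` and `Y₀ ∼ μ`. -/
noncomputable def changeLaw (μ : Measure 𝓨) [IsProbabilityMeasure μ] (κ₀ κ₁ : Kernel 𝓨 𝓨)
    [IsMarkovKernel κ₀] [IsMarkovKernel κ₁] (ν : ℕ) : Measure (ℕ → 𝓨) :=
  markovLaw μ (changeKernel κ₀ κ₁ ν)

variable [MeasurableSpace.CountableOrCountablyGenerated 𝓨 𝓨]

/-- The log-likelihood ratio `Z_t = ln (f₁(Y_t | Y_{t-1}) / f₀(Y_t | Y_{t-1}))`, for `t ≥ 1`. -/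
noncomputable def logLikelihoodRatio (κ₀ κ₁ : Kernel 𝓨 𝓨) (t : ℕ) (ω : ℕ → 𝓨) : ℝ :=
  Real.log (Kernel.rnDeriv κ₁ κ₀ (ω (t - 1)) (ω t)).toReal

/-- `I` is the average information per observation for discriminating `κ₁` from `κ₀`, that is, the
inverse of the privacy level of the observations `Y₀, Y₁, …`, where `Y₀ ∼ μ`:
* after the change, the likelihood ratios are almost surely finite;
* `n⁻¹ ∑_{t=ν}^{ν+n} Z_t → I` almost surely under `ℙ_ν`, for every change time `ν ≥ 1`;
* for every `δ > 0`, as `n → ∞`,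
  `sup_{ν ≥ 1} ess sup ℙ_ν (max_{t ≤ n} ∑_{i=ν}^{ν+t} Z_i > I (1 + δ) n | Y₀, …, Y_{ν-1}) → 0`. -/
def IsInformationRate (μ : Measure 𝓨) [IsProbabilityMeasure μ] (κ₀ κ₁ : Kernel 𝓨 𝓨)
    [IsMarkovKernel κ₀] [IsMarkovKernel κ₁] (I : ℝ) : Prop :=
  (∀ ν : ℕ, 1 ≤ ν → ∀ᵐ ω ∂(changeLaw μ κ₀ κ₁ ν), ∀ t : ℕ, ν ≤ t →
    Kernel.rnDeriv κ₁ κ₀ (ω (t - 1)) (ω t) ≠ ⊤) ∧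
  (∀ ν : ℕ, 1 ≤ ν → ∀ᵐ ω ∂(changeLaw μ κ₀ κ₁ ν),
    Tendsto (fun n : ℕ ↦ (n : ℝ)⁻¹ * ∑ t ∈ Finset.Icc ν (ν + n), logLikelihoodRatio κ₀ κ₁ t ω)
      atTop (𝓝 I)) ∧
  (∀ δ : ℝ, 0 < δ →
    Tendsto (fun n : ℕ ↦ ⨆ (ν : ℕ) (_ : 1 ≤ ν),
      essSup (fun ω ↦ ENNReal.ofReal
        (((changeLaw μ κ₀ κ₁ ν)⟦{ω' | ∃ t ≤ n, I * (1 + δ) * n <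
            ∑ i ∈ Finset.Icc ν (ν + t), logLikelihoodRatio κ₀ κ₁ i ω'} |
          Filtration.piLE (X := fun _ ↦ 𝓨) (ν - 1)⟧) ω)) (changeLaw μ κ₀ κ₁ ν))
      atTop (𝓝 0))

end MarkovChains

section Values

variable {𝓧 𝓤 : Type*} [MeasurableSpace 𝓧] [MeasurableSpace 𝓤]

/-- The transition kernel of the state-action pairs `Y_t = (X_t, U_t)` when the randomized policy `π`
is used: `X_{t+1} ∼ P(· | X_t, U_t)` and `U_{t+1} ∼ π(· | X_{t+1})`. -/
noncomputable def MDP.pairKernel (M : MDP 𝓧 𝓤) (π : Kernel 𝓧 𝓤) : Kernel (𝓧 × 𝓤) (𝓧 × 𝓤) :=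
  M.trans ⊗ₖ Kernel.prodMkLeft (𝓧 × 𝓤) π

instance (M : MDP 𝓧 𝓤) (π : Kernel 𝓧 𝓤) [IsMarkovKernel π] : IsMarkovKernel (M.pairKernel π) := by
  unfold MDP.pairKernel; infer_instance

/-- The transition kernel of the states `X_t` when the randomized policy `π` is used. -/
noncomputable def MDP.stateKernel (M : MDP 𝓧 𝓤) (π : Kernel 𝓧 𝓤) : Kernel 𝓧 𝓧 :=
  M.trans ∘ₖ (Kernel.id ×ₖ π)

/-- `v` is the value of the policy `π` in `M`: from every initial state `x`, the rewards are
integrable and `𝔼[(1/N) ∑_{t<N} r(X_t, U_t)] → v`. -/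
def MDP.IsValue (M : MDP 𝓧 𝓤) (π : Kernel 𝓧 𝓤) [IsMarkovKernel π] (v : ℝ) : Prop :=
  ∀ x : 𝓧,
    (∀ t : ℕ, Integrable (fun ω ↦ M.reward (ω t))
      (markovLaw (Measure.dirac x ⊗ₘ π) (fun _ ↦ M.pairKernel π))) ∧
    Tendsto (fun N : ℕ ↦ ∫ ω, (N : ℝ)⁻¹ * ∑ t ∈ Finset.range N, M.reward (ω t)
      ∂(markovLaw (Measure.dirac x ⊗ₘ π) (fun _ ↦ M.pairKernel π))) atTop (𝓝 v)

variable [MeasurableSpace.CountableOrCountablyGenerated (𝓧 × 𝓤) (𝓧 × 𝓤)]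

/-- `I` is the full-information rate `I_F(π₀, π₁)`, the inverse of the privacy level of the
observations `Y_t = (X_t, U_t)`, when `(M₀, π₀)` is replaced by `(M₁, π₁)` at the change and the
system is stationary before the change. -/
def IsFullInformationRate (M₀ M₁ : MDP 𝓧 𝓤) (π₀ π₁ : Kernel 𝓧 𝓤) [IsMarkovKernel π₀]
    [IsMarkovKernel π₁] (I : ℝ) : Prop :=
  (∃ μ : Measure 𝓧, IsProbabilityMeasure μ ∧ Kernel.Invariant (M₀.stateKernel π₀) μ) ∧
  ∀ (μ : Measure 𝓧) [IsProbabilityMeasure μ], Kernel.Invariant (M₀.stateKernel π₀) μ →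
    IsInformationRate (μ ⊗ₘ π₀) (M₀.pairKernel π₀) (M₁.pairKernel π₁) I

/-- `v` is the value `ρ V_{M₁}^{π₁} + (1 - ρ) V_{M₀}^{π₀} - lam I_F(π₀, π₁)` of the full-information
utility-privacy function at `(π₀, π₁)`. -/
def IsUtilityPrivacyValue (M₀ M₁ : MDP 𝓧 𝓤) (ρ lam : ℝ) (π₀ π₁ : Kernel 𝓧 𝓤) [IsMarkovKernel π₀]
    [IsMarkovKernel π₁] (v : ℝ) : Prop :=
  ∃ v₀ v₁ I : ℝ, M₀.IsValue π₀ v₀ ∧ M₁.IsValue π₁ v₁ ∧ IsFullInformationRate M₀ M₁ π₀ π₁ I ∧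
    v = ρ * v₁ + (1 - ρ) * v₀ - lam * I

end Values

/-! ### Linear systems -/

/-- The Gaussian kernel `y ↦ 𝒩(f y, S)`. -/
noncomputable def gaussianKernel {𝓨 : Type*} [MeasurableSpace 𝓨] {n : ℕ}
    (f : 𝓨 → EuclideanSpace ℝ (Fin n)) (hf : Measurable f) (S : Matrix (Fin n) (Fin n) ℝ) :
    Kernel 𝓨 (EuclideanSpace ℝ (Fin n)) where
  toFun y := multivariateGaussian (f y) S
  measurable' := by
    refine Measure.measurable_of_measurable_coe _ fun s hs ↦ ?_
    have hg : Measurable (fun p : 𝓨 × EuclideanSpace ℝ (Fin n) ↦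
        f p.1 + toEuclideanCLM (𝕜 := ℝ) (CFC.sqrt S) p.2) := by fun_prop
    have h : ∀ y, multivariateGaussian (f y) S s =
        stdGaussian (EuclideanSpace ℝ (Fin n)) (Prod.mk y ⁻¹'
          ((fun p : 𝓨 × EuclideanSpace ℝ (Fin n) ↦
            f p.1 + toEuclideanCLM (𝕜 := ℝ) (CFC.sqrt S) p.2) ⁻¹' s)) := by
      intro y
      rw [multivariateGaussian, Measure.map_apply (by fun_prop) hs]
      rfl
    simp_rw [h]
    exact measurable_measure_prodMk_left (hg hs)

instance {𝓨 : Type*} [MeasurableSpace 𝓨] {n : ℕ}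
    (f : 𝓨 → EuclideanSpace ℝ (Fin n)) (hf : Measurable f) (S : Matrix (Fin n) (Fin n) ℝ) :
    IsMarkovKernel (gaussianKernel f hf S) :=
  ⟨fun y ↦ inferInstanceAs (IsProbabilityMeasure (multivariateGaussian (f y) S))⟩

/-- A real square matrix is Schur if all its complex eigenvalues have modulus less than one. -/
def Matrix.IsSchur {n : ℕ} (M : Matrix (Fin n) (Fin n) ℝ) : Prop :=
  ∀ z ∈ spectrum ℂ (M.map ((↑) : ℝ → ℂ)), ‖z‖ < 1

section LinearSystems

variable {n m : ℕ}

/-- The system `x_{t+1} = A x_t + B u_t + d + w_t` with `w_t ∼ 𝒩(0, Q)` independent and identically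
distributed, and with reward `-xᵀx`. -/
noncomputable def linearMDP (A : Matrix (Fin n) (Fin n) ℝ) (B : Matrix (Fin n) (Fin m) ℝ)
    (d : Fin n → ℝ) (Q : Matrix (Fin n) (Fin n) ℝ) :
    MDP (EuclideanSpace ℝ (Fin n)) (EuclideanSpace ℝ (Fin m)) where
  trans := gaussianKernel
    (fun p ↦ WithLp.toLp 2 (A *ᵥ p.1.ofLp + B *ᵥ p.2.ofLp + d)) (by fun_prop) Q
  isMarkov := inferInstance
  reward p := -(p.1.ofLp ⬝ᵥ p.1.ofLp)

/-- The policy `u_t = K x_t + β_t` with `β_t ∼ 𝒩(α, R)` independent and identically distributed. -/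
noncomputable def linearPolicy (K : Matrix (Fin m) (Fin n) ℝ) (R : Matrix (Fin m) (Fin m) ℝ)
    (α : Fin m → ℝ) : Kernel (EuclideanSpace ℝ (Fin n)) (EuclideanSpace ℝ (Fin m)) :=
  gaussianKernel (fun x ↦ WithLp.toLp 2 (K *ᵥ x.ofLp + α)) (by fun_prop) R

instance (K : Matrix (Fin m) (Fin n) ℝ) (R : Matrix (Fin m) (Fin m) ℝ) (α : Fin m → ℝ) :
    IsMarkovKernel (linearPolicy K R α) := by
  unfold linearPolicy; infer_instance

/-- `v` is the value of the full-information utility-privacy function of the linear system at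
`(α₀, α₁)`. Before the change there is no exogenous input; after it the input is `F θ`. -/
def IsLinearUtilityPrivacyValue {k : ℕ} (A : Matrix (Fin n) (Fin n) ℝ)
    (B : Matrix (Fin n) (Fin m) ℝ) (F : Matrix (Fin n) (Fin k) ℝ) (θ : Fin k → ℝ)
    (Q : Matrix (Fin n) (Fin n) ℝ) (K : Matrix (Fin m) (Fin n) ℝ) (R : Matrix (Fin m) (Fin m) ℝ)
    (ρ lam : ℝ) (α₀ α₁ : Fin m → ℝ) (v : ℝ) : Prop :=
  IsUtilityPrivacyValue (linearMDP A B 0 Q) (linearMDP A B (F *ᵥ θ) Q) ρ lam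
    (linearPolicy K R α₀) (linearPolicy K R α₁) v

/-- The function `V_F(ρ, lam, α₀, α₁)` of the linear system. -/
noncomputable def linearVF {k : ℕ} (A : Matrix (Fin n) (Fin n) ℝ)
    (B : Matrix (Fin n) (Fin m) ℝ) (F : Matrix (Fin n) (Fin k) ℝ) (θ : Fin k → ℝ)
    (Q : Matrix (Fin n) (Fin n) ℝ) (K : Matrix (Fin m) (Fin n) ℝ) (R : Matrix (Fin m) (Fin m) ℝ)
    (ρ lam : ℝ) (α₀ α₁ : Fin m → ℝ) : ℝ :=
  Classical.epsilon (IsLinearUtilityPrivacyValue A B F θ Q K R ρ lam α₀ α₁)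

end LinearSystems

/-! ### Powers of Schur matrices and the Lyapunov equation -/

section MatrixDynamics

variable {n : ℕ}

-- Write `N = A + BK`. In closed loop the state follows `x ↦ N x + (B α + d) + noise`, the noise
-- having covariance `B R Bᵀ + Q`. From a point, the state is therefore Gaussian at all times, with
-- explicit recursions for its mean and covariance. As `N ^ t → 0`, the means tend to `L⁻¹ (B α +
-- d)` and the covariances to the Lyapunov solution. The expected rewards thus converge, and so do
-- their Cesàro means (`isValue_linearMDP`).
--
-- For the information rate, both regimes share `N`, `K`, `Q` and `R`; the change only shifts two
-- Gaussian means, by `F θ` and `α₁ - α₀`. By Cameron-Martin the log-likelihood ratio is affine, and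
-- under the post-change kernel it has law `𝒩(I, 2I)` whatever the previous observation. After the
-- change the ratios are thus i.i.d. and independent of the past. The rate `I` is their mean by the
-- strong law; the conditional probabilities are constants, which a Chernoff bound controls
-- uniformly in `ν` (`isInformationRate_of_map_eq_gaussianReal`).
--
-- Hence `V_F` is a constant minus `quadraticLoss`. The second-order part of this loss is positive
-- definite for `λ > 0`, so a critical point is the only maximizer of `V_F`, and the stated formulas
-- solve the linear critical-point equations.

attribute [local instance] Matrix.linftyOpNormedRing Matrix.linftyOpNormedAlgebra in
theorem tendsto_pow_of_forall_spectrum_norm_lt_one (M : Matrix (Fin n) (Fin n) ℂ)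
    (h : ∀ z ∈ spectrum ℂ M, ‖z‖ < 1) : Tendsto (fun t : ℕ ↦ M ^ t) atTop (𝓝 0) := by
  rcases Nat.eq_zero_or_pos n with rfl | hn
  · exact tendsto_const_nhds.congr fun t ↦ Subsingleton.elim _ _
  have : Nonempty (Fin n) := ⟨⟨0, hn⟩⟩
  have : CompleteSpace (Matrix (Fin n) (Fin n) ℂ) := FiniteDimensional.complete ℂ _
  have hlt : spectralRadius ℂ M < (1 : NNReal) :=
    spectrum.spectralRadius_lt_of_forall_lt M fun z hz ↦ by
      have := h z hz
      exact_mod_cast this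
  obtain ⟨r, hr, hr1⟩ := ENNReal.lt_iff_exists_nnreal_btwn.1 hlt
  -- Gelfand's formula, with `r` strictly between the spectral radius and 1, gives `‖M ^ t‖ ≤ r ^ t`
  -- eventually.
  have hev := (spectrum.pow_nnnorm_pow_one_div_tendsto_nhds_spectralRadius M).eventually_lt_const hr
  have hr1' : r < 1 := by exact_mod_cast hr1
  refine squeeze_zero_norm' ?_ (NNReal.tendsto_coe.2 (NNReal.tendsto_pow_atTop_nhds_zero_of_lt_one hr1'))
  filter_upwards [hev, eventually_gt_atTop 0] with t ht ht0
  have ht0' : (0 : ℝ) < t := by exact_mod_cast ht0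
  have h1 := ENNReal.rpow_le_rpow ht.le ht0'.le
  rw [← ENNReal.rpow_mul, one_div, inv_mul_cancel₀ ht0'.ne', ENNReal.rpow_one,
    ENNReal.rpow_natCast] at h1
  have h2 : ‖M ^ t‖₊ ≤ r ^ t := by exact_mod_cast h1
  exact_mod_cast h2

theorem Matrix.IsSchur.tendsto_pow {N : Matrix (Fin n) (Fin n) ℝ} (hN : N.IsSchur) :
    Tendsto (fun t : ℕ ↦ N ^ t) atTop (𝓝 0) := by
  have h := tendsto_pow_of_forall_spectrum_norm_lt_one _ hN
  have h2 := ((continuous_id.matrix_map Complex.continuous_re).tendsto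
    (0 : Matrix (Fin n) (Fin n) ℂ)).comp h
  refine (h2.congr fun t ↦ ?_).trans_eq ?_
  · have : (N.map ((↑) : ℝ → ℂ)) ^ t = (N ^ t).map ((↑) : ℝ → ℂ) :=
      (map_pow (Complex.ofRealHom.mapMatrix : Matrix (Fin n) (Fin n) ℝ →+* _) N t).symm
    ext i j
    simp [this]
  · congr 1

theorem Matrix.IsSchur.tendsto_pow_mul_mul {N : Matrix (Fin n) (Fin n) ℝ} (hN : N.IsSchur)
    (X : Matrix (Fin n) (Fin n) ℝ) :
    Tendsto (fun t : ℕ ↦ N ^ t * X * (N ^ t)ᵀ) atTop (𝓝 0) := by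
  have hT := (continuous_id.matrix_transpose.tendsto (0 : Matrix (Fin n) (Fin n) ℝ)).comp
    hN.tendsto_pow
  simpa using (hN.tendsto_pow.mul_const X).mul hT

theorem Matrix.IsSchur.tendsto_pow_mulVec {N : Matrix (Fin n) (Fin n) ℝ} (hN : N.IsSchur)
    (x : Fin n → ℝ) : Tendsto (fun t : ℕ ↦ N ^ t *ᵥ x) atTop (𝓝 0) := by
  have h : Continuous fun M : Matrix (Fin n) (Fin n) ℝ ↦ M *ᵥ x :=
    continuous_id.matrix_mulVec continuous_const
  simpa [Function.comp_def] using (h.tendsto 0).comp hN.tendsto_pow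

theorem Matrix.IsSchur.eq_zero_of_mulVec_eq {N : Matrix (Fin n) (Fin n) ℝ} (hN : N.IsSchur)
    {x : Fin n → ℝ} (hx : N *ᵥ x = x) : x = 0 := by
  have hc : ∀ t : ℕ, N ^ t *ᵥ x = x := fun t ↦ by
    induction t with
    | zero => simp
    | succ t ih => rw [pow_succ, ← mulVec_mulVec, hx, ih]
  exact tendsto_nhds_unique (tendsto_const_nhds.congr fun t ↦ (hc t).symm) (hN.tendsto_pow_mulVec x)

theorem Matrix.IsSchur.isUnit_det_one_sub {N : Matrix (Fin n) (Fin n) ℝ} (hN : N.IsSchur) :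
    IsUnit (1 - N).det := by
  rw [← isUnit_iff_isUnit_det, ← mulVec_injective_iff_isUnit]
  refine (injective_iff_map_eq_zero (1 - N).mulVecLin).2 fun x hx ↦ ?_
  refine hN.eq_zero_of_mulVec_eq ?_
  rw [mulVecLin_apply, sub_mulVec, one_mulVec, sub_eq_zero] at hx
  exact hx.symm

/-- Iterating the equation reproduces `X` as `N ^ t * X * (N ^ t)ᵀ`, which tends to 0. This is
uniqueness for the Lyapunov equation. -/
theorem Matrix.IsSchur.eq_zero_of_mul_mul_transpose_eq {N : Matrix (Fin n) (Fin n) ℝ}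
    (hN : N.IsSchur) {X : Matrix (Fin n) (Fin n) ℝ} (hX : N * X * Nᵀ = X) : X = 0 := by
  have hc : ∀ t : ℕ, N ^ t * X * (N ^ t)ᵀ = X := fun t ↦ by
    induction t with
    | zero => simp
    | succ t ih =>
      calc N ^ (t + 1) * X * (N ^ (t + 1))ᵀ = N ^ t * (N * X * Nᵀ) * (N ^ t)ᵀ := by
            rw [pow_succ, transpose_mul]; simp only [Matrix.mul_assoc]
        _ = X := by rw [hX, ih]
  exact tendsto_nhds_unique (tendsto_const_nhds.congr fun t ↦ (hc t).symm)
    (hN.tendsto_pow_mul_mul X)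

/-- The mean of a linear system driven by a constant input. -/
def affineIterate (N : Matrix (Fin n) (Fin n) ℝ) (b x : Fin n → ℝ) : ℕ → Fin n → ℝ
  | 0 => x
  | t + 1 => N *ᵥ affineIterate N b x t + b

/-- The covariance of a linear system driven by white noise and started at a point. -/
def covarianceIterate (N W : Matrix (Fin n) (Fin n) ℝ) : ℕ → Matrix (Fin n) (Fin n) ℝ
  | 0 => 0
  | t + 1 => N * covarianceIterate N W t * Nᵀ + W

theorem Matrix.IsSchur.tendsto_affineIterate {N : Matrix (Fin n) (Fin n) ℝ} (hN : N.IsSchur)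
    (b x : Fin n → ℝ) :
    Tendsto (affineIterate N b x) atTop (𝓝 ((1 - N)⁻¹ *ᵥ b)) := by
  set y := (1 - N)⁻¹ *ᵥ b with hy
  have hfix : N *ᵥ y + b = y := by
    have h : (1 - N) *ᵥ y = b := by
      rw [hy, mulVec_mulVec, mul_nonsing_inv _ hN.isUnit_det_one_sub, one_mulVec]
    rw [sub_mulVec, one_mulVec] at h
    rw [← h]; abel
  clear_value y
  -- Each step multiplies the deviation from the fixed point `y` by `N`.
  have hform : ∀ t, affineIterate N b x t = y + N ^ t *ᵥ (x - y) := fun t ↦ by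
    induction t with
    | zero => simp [affineIterate]
    | succ t ih =>
      rw [affineIterate, ih, mulVec_add, pow_succ', mulVec_mulVec, add_right_comm, hfix]
  rw [show 𝓝 y = 𝓝 (y + 0) by rw [add_zero]]
  exact ((hN.tendsto_pow_mulVec (x - y)).const_add y).congr fun t ↦ (hform t).symm

theorem Matrix.IsSchur.tendsto_covarianceIterate {N W S : Matrix (Fin n) (Fin n) ℝ}
    (hN : N.IsSchur) (hS : S = N * S * Nᵀ + W) :
    Tendsto (covarianceIterate N W) atTop (𝓝 S) := by
  have hform : ∀ t, covarianceIterate N W t = S - N ^ t * S * (N ^ t)ᵀ := fun t ↦ by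
    induction t with
    | zero => simp [covarianceIterate]
    | succ t ih =>
      rw [covarianceIterate, ih, pow_succ', transpose_mul, mul_sub, sub_mul]
      nth_rw 3 [hS]
      simp only [Matrix.mul_assoc]
      abel
  rw [show 𝓝 S = 𝓝 (S - 0) by rw [sub_zero]]
  exact ((hN.tendsto_pow_mul_mul S).const_sub S).congr fun t ↦ (hform t).symm

theorem posSemidef_covarianceIterate {N W : Matrix (Fin n) (Fin n) ℝ} (hW : W.PosSemidef) (t : ℕ) :
    (covarianceIterate N W t).PosSemidef := by
  induction t with
  | zero => exact PosSemidef.zero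
  | succ t ih =>
    have := ih.mul_mul_conjTranspose_same N
    rw [conjTranspose_eq_transpose_of_trivial] at this
    exact this.add hW

theorem posSemidef_of_tendsto {M : ℕ → Matrix (Fin n) (Fin n) ℝ} {S : Matrix (Fin n) (Fin n) ℝ}
    (hM : ∀ t, (M t).PosSemidef) (h : Tendsto M atTop (𝓝 S)) : S.PosSemidef := by
  refine PosSemidef.of_dotProduct_mulVec_nonneg ?_ fun x ↦ ?_
  · have hT := (continuous_id.matrix_conjTranspose.tendsto S).comp h
    exact tendsto_nhds_unique (hT.congr fun t ↦ (hM t).isHermitian) h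
  · have hc : Continuous fun M : Matrix (Fin n) (Fin n) ℝ ↦ star x ⬝ᵥ M *ᵥ x :=
      continuous_const.dotProduct (continuous_id.matrix_mulVec continuous_const)
    exact ge_of_tendsto' ((hc.tendsto S).comp h) fun t ↦ (hM t).dotProduct_mulVec_nonneg x

/-- The discrete Lyapunov equation of a Schur matrix has exactly one solution. -/
theorem Matrix.IsSchur.exists_lyapunov {N W : Matrix (Fin n) (Fin n) ℝ} (hN : N.IsSchur)
    (hW : W.PosDef) : ∃ S : Matrix (Fin n) (Fin n) ℝ, S.PosDef ∧ S = N * S * Nᵀ + W ∧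
      ∀ S' : Matrix (Fin n) (Fin n) ℝ, S' = N * S' * Nᵀ + W → S' = S := by
  let Φ : Matrix (Fin n) (Fin n) ℝ →ₗ[ℝ] Matrix (Fin n) (Fin n) ℝ :=
    LinearMap.id - LinearMap.mulLeftRight ℝ (N, Nᵀ)
  have hΦ : ∀ X, Φ X = X - N * X * Nᵀ := fun X ↦ by simp [Φ]
  have hinj : Function.Injective Φ := (injective_iff_map_eq_zero Φ).2 fun X hX ↦
    hN.eq_zero_of_mul_mul_transpose_eq (by rw [hΦ, sub_eq_zero] at hX; exact hX.symm)
  -- In finite dimension, uniqueness gives existence.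
  obtain ⟨S, hS⟩ := LinearMap.surjective_of_injective hinj W
  have hS' : S = N * S * Nᵀ + W := by rw [← hS, hΦ]; abel
  refine ⟨S, ?_, hS', fun S' h ↦ hinj ?_⟩
  -- As a limit of covariances `S` is only semidefinite; the equation then adds the definite `W`.
  · have hpsd := posSemidef_of_tendsto (posSemidef_covarianceIterate hW.posSemidef)
      (hN.tendsto_covarianceIterate hS')
    rw [hS']
    have := hpsd.mul_mul_conjTranspose_same N
    rw [conjTranspose_eq_transpose_of_trivial] at this
    exact PosDef.posSemidef_add this hW
  · rw [hS, hΦ]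
    nth_rw 1 [h]
    abel

end MatrixDynamics

/-! ### Independence along a filtration -/

section Independence

/-- Induction on the largest index `a + 1` of a finite family: the events of smaller index all lie
in `F a`, so the last event splits off. -/
theorem iIndep_nat_of_indep_filtration {Ω : Type*} {mΩ : MeasurableSpace Ω} {P : Measure Ω}
    [IsProbabilityMeasure P] {m : ℕ → MeasurableSpace Ω} {F : ℕ → MeasurableSpace Ω}
    (hF : Monotone F) (hm : ∀ i, m i ≤ F i) (h : ∀ i, Indep (F i) (m (i + 1)) P) :
    iIndep m P := by
  rw [iIndep_iff]
  intro s
  induction s using Finset.induction_on_max with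
  | empty => simp
  | insert a s hs ih =>
    intro f hf
    have has : a ∉ s := fun ha ↦ lt_irrefl a (hs a ha)
    rw [Finset.set_biInter_insert, Finset.prod_insert has,
      ← ih fun i hi ↦ hf i (Finset.mem_insert_of_mem hi)]
    rcases a with _ | a
    · have : s = ∅ := Finset.eq_empty_of_forall_notMem fun x hx ↦ by simpa using hs x hx
      subst this
      simp
    · rw [Set.inter_comm, mul_comm]
      refine Indep_iff _ _ _ |>.1 (h a) _ _ ?_ (hf _ (Finset.mem_insert_self _ _))
      refine MeasurableSet.biInter s.countable_toSet fun i hi ↦ ?_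
      exact hF (Nat.lt_succ_iff.1 (hs i hi)) _ (hm i _ (hf i (Finset.mem_insert_of_mem hi)))

end Independence

/-! ### Images of composition products -/

section CompProd

variable {α β γ : Type*} [MeasurableSpace α] [MeasurableSpace β] [MeasurableSpace γ]

/-- A conditional law that does not depend on the condition means independence. All independence in
the proof comes from here. -/
theorem map_compProd_of_map_eq {μ : Measure α} [SFinite μ] {κ : Kernel α β} [IsMarkovKernel κ]
    {g : α → β → γ} (hg : Measurable (Function.uncurry g)) {η : Measure γ} [SFinite η]
    (h : ∀ x, (κ x).map (g x) = η) :
    (μ ⊗ₘ κ).map (fun p ↦ (p.1, g p.1 p.2)) = μ.prod η := by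
  have hm : Measurable fun p : α × β ↦ (p.1, g p.1 p.2) := measurable_fst.prodMk hg
  ext s hs
  rw [Measure.map_apply hm hs, Measure.compProd_apply (hm hs), Measure.prod_apply hs]
  refine lintegral_congr fun x ↦ ?_
  have hgx : Measurable (g x) := hg.comp measurable_prodMk_left
  rw [← h x, Measure.map_apply hgx (measurable_prodMk_left hs)]
  rfl

theorem map_prodMap_compProd_comap {μ : Measure α} [SFinite μ] {κ : Kernel γ β} [IsMarkovKernel κ]
    {f : α → γ} (hf : Measurable f) :
    (μ ⊗ₘ κ.comap f hf).map (Prod.map f id) = μ.map f ⊗ₘ κ := by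
  have hm : Measurable (Prod.map f id : α × β → γ × β) := hf.prodMap measurable_id
  ext s hs
  rw [Measure.map_apply hm hs, Measure.compProd_apply (hm hs), Measure.compProd_apply hs,
    lintegral_map (Kernel.measurable_kernel_prodMk_left hs) hf]
  rfl

end CompProd

/-! ### Marginals and innovations of Markov chains -/

section MarkovLaw

variable {𝓨 : Type*} [MeasurableSpace 𝓨] {μ : Measure 𝓨} [IsProbabilityMeasure μ]
  {κ : ℕ → Kernel 𝓨 𝓨} [∀ t, IsMarkovKernel (κ t)]

instance : IsProbabilityMeasure (markovLaw μ κ) := by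
  unfold markovLaw; infer_instance

instance {κ₀ κ₁ : Kernel 𝓨 𝓨} [IsMarkovKernel κ₀] [IsMarkovKernel κ₁] (ν : ℕ) :
    IsProbabilityMeasure (changeLaw μ κ₀ κ₁ ν) := by
  unfold changeLaw; infer_instance

theorem markovLaw_map_frestrictLe_succ (a : ℕ) :
    (markovLaw μ κ).map (fun ω ↦ (Preorder.frestrictLe (π := fun _ : ℕ ↦ 𝓨) a ω, ω (a + 1))) =
      (markovLaw μ κ).map (Preorder.frestrictLe (π := fun _ : ℕ ↦ 𝓨) a) ⊗ₘ
        (κ a).comap (fun h : (Π _ : Finset.Iic a, 𝓨) ↦ h ⟨a, Finset.mem_Iic.2 le_rfl⟩)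
          (measurable_pi_apply _) :=
  Kernel.map_frestrictLe_trajMeasure_compProd_eq_map_trajMeasure.symm

theorem markovLaw_map_pair (a : ℕ) :
    (markovLaw μ κ).map (fun ω ↦ (ω a, ω (a + 1))) =
      (markovLaw μ κ).map (fun ω ↦ ω a) ⊗ₘ κ a := by
  have h := congrArg (Measure.map (Prod.map
    (fun h : (Π _ : Finset.Iic a, 𝓨) ↦ h ⟨a, Finset.mem_Iic.2 le_rfl⟩) (id : 𝓨 → 𝓨)))
    (markovLaw_map_frestrictLe_succ (μ := μ) (κ := κ) a)
  rw [map_prodMap_compProd_comap, Measure.map_map (by fun_prop) (by fun_prop),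
    Measure.map_map (by fun_prop) (by fun_prop)] at h
  exact h

theorem markovLaw_map_succ (a : ℕ) :
    (markovLaw μ κ).map (fun ω ↦ ω (a + 1)) = ((markovLaw μ κ).map (fun ω ↦ ω a)).bind (κ a) := by
  have h := congrArg Measure.snd (markovLaw_map_pair (μ := μ) (κ := κ) a)
  rw [Measure.snd_compProd, Measure.snd, Measure.map_map (by fun_prop) (by fun_prop)] at h
  exact h

theorem markovLaw_map_zero : (markovLaw μ κ).map (fun ω ↦ ω 0) = μ := by
  have h0 : (fun ω : ℕ → 𝓨 ↦ ω 0) =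
      (fun h : (Π _ : Finset.Iic 0, 𝓨) ↦ h ⟨0, Finset.mem_Iic.2 le_rfl⟩) ∘
        (Preorder.frestrictLe (π := fun _ : ℕ ↦ 𝓨) 0) := rfl
  rw [h0, ← Measure.map_map (by fun_prop) (by fun_prop), markovLaw, Kernel.trajMeasure,
    Measure.map_comp _ _ (by fun_prop), Kernel.traj_map_frestrictLe, Kernel.partialTraj_self,
    Measure.id_comp, Measure.map_map (by fun_prop) (by fun_prop)]
  exact Measure.map_id

theorem measurable_increment {g : 𝓨 → 𝓨 → ℝ} (hg : Measurable (Function.uncurry g)) (a : ℕ) :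
    Measurable fun ω : ℕ → 𝓨 ↦ g (ω a) (ω (a + 1)) :=
  hg.comp (f := fun ω : ℕ → 𝓨 ↦ (ω a, ω (a + 1))) (by fun_prop)

/-- If the transformed transition `g y` has law `η` under every `κ a y`, then `g (Y_a) (Y_{a+1})` is
independent of the past up to time `a`. -/
theorem markovLaw_map_innovation {a : ℕ} {g : 𝓨 → 𝓨 → ℝ} (hg : Measurable (Function.uncurry g))
    {η : Measure ℝ} [SFinite η] (h : ∀ y, (κ a y).map (g y) = η) :
    (markovLaw μ κ).map
        (fun ω ↦ (Preorder.frestrictLe (π := fun _ : ℕ ↦ 𝓨) a ω, g (ω a) (ω (a + 1)))) =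
      ((markovLaw μ κ).map (Preorder.frestrictLe (π := fun _ : ℕ ↦ 𝓨) a)).prod η := by
  let g' : (Π _ : Finset.Iic a, 𝓨) → 𝓨 → ℝ := fun x ↦ g (x ⟨a, Finset.mem_Iic.2 le_rfl⟩)
  have hg' : Measurable (Function.uncurry g') :=
    hg.comp (f := fun p : (Π _ : Finset.Iic a, 𝓨) × 𝓨 ↦
      (p.1 ⟨a, Finset.mem_Iic.2 le_rfl⟩, p.2)) (by fun_prop)
  have := Measure.isProbabilityMeasure_map (μ := markovLaw μ κ)
    (f := Preorder.frestrictLe (π := fun _ : ℕ ↦ 𝓨) a) (by fun_prop)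
  rw [← map_compProd_of_map_eq (κ := (κ a).comap _ (measurable_pi_apply _)) hg'
    (fun x ↦ h (x ⟨a, Finset.mem_Iic.2 le_rfl⟩)), ← markovLaw_map_frestrictLe_succ,
    Measure.map_map (g := fun p : (Π _ : Finset.Iic a, 𝓨) × 𝓨 ↦ (p.1, g' p.1 p.2))
      (measurable_fst.prodMk hg') (by fun_prop)]
  rfl

theorem markovLaw_map_increment {a : ℕ} {g : 𝓨 → 𝓨 → ℝ} (hg : Measurable (Function.uncurry g))
    {η : Measure ℝ} [SFinite η] (h : ∀ y, (κ a y).map (g y) = η) :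
    (markovLaw μ κ).map (fun ω ↦ g (ω a) (ω (a + 1))) = η := by
  have hg1 : Measurable fun ω : ℕ → 𝓨 ↦ g (ω a) (ω (a + 1)) :=
    measurable_increment hg a
  have := Measure.isProbabilityMeasure_map (μ := markovLaw μ κ)
    (f := Preorder.frestrictLe (π := fun _ : ℕ ↦ 𝓨) a) (by fun_prop)
  have h1 := congrArg Measure.snd (markovLaw_map_innovation (μ := μ) hg h)
  rw [Measure.snd, Measure.map_map (by fun_prop) (by fun_prop), Measure.snd_prod] at h1
  exact h1

theorem markovLaw_indep_increment {a : ℕ} {g : 𝓨 → 𝓨 → ℝ} (hg : Measurable (Function.uncurry g))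
    {η : Measure ℝ} [SFinite η] (h : ∀ y, (κ a y).map (g y) = η) :
    Indep (Filtration.piLE (X := fun _ : ℕ ↦ 𝓨) a)
      (MeasurableSpace.comap (fun ω : ℕ → 𝓨 ↦ g (ω a) (ω (a + 1))) inferInstance)
      (markovLaw μ κ) := by
  have hg1 : Measurable fun ω : ℕ → 𝓨 ↦ g (ω a) (ω (a + 1)) :=
    measurable_increment hg a
  have h2 := (indepFun_iff_map_prod_eq_prod_map_map (μ := markovLaw μ κ)
    (f := Preorder.frestrictLe (π := fun _ : ℕ ↦ 𝓨) a) (by fun_prop) hg1.aemeasurable).2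
    (by rw [markovLaw_map_increment hg h]; exact markovLaw_map_innovation hg h)
  rw [IndepFun_iff_Indep] at h2
  rw [Filtration.piLE_eq_comap_frestrictLe]
  exact h2

/-- Index 0 carries the whole past up to time `a`, and index `i + 1` the increment from `a + i` to
`a + i + 1`. One family thus yields both the mutual independence of the increments and their
independence of the past. -/
theorem markovLaw_iIndep {a : ℕ} {g : 𝓨 → 𝓨 → ℝ} (hg : Measurable (Function.uncurry g))
    {η : Measure ℝ} [SFinite η] (h : ∀ t, a ≤ t → ∀ y, (κ t y).map (g y) = η) :
    iIndep (fun i : ℕ ↦ Nat.casesOn i (Filtration.piLE (X := fun _ : ℕ ↦ 𝓨) a)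
      (fun i ↦ MeasurableSpace.comap (fun ω : ℕ → 𝓨 ↦ g (ω (a + i)) (ω (a + i + 1))) inferInstance))
      (markovLaw μ κ) := by
  refine iIndep_nat_of_indep_filtration
    (F := fun i ↦ Filtration.piLE (X := fun _ : ℕ ↦ 𝓨) (a + i))
    (fun i j hij ↦ (Filtration.piLE (X := fun _ : ℕ ↦ 𝓨)).mono (by omega)) ?_
    fun i ↦ markovLaw_indep_increment hg (h _ (by omega))
  have hmeas : ∀ s t : ℕ, s ≤ t → Measurable[Filtration.piLE (X := fun _ : ℕ ↦ 𝓨) t]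
      fun ω : ℕ → 𝓨 ↦ ω s := fun s t hst ↦ by
    have h1 : Measurable[Filtration.piLE (X := fun _ : ℕ ↦ 𝓨) t]
        (Preorder.frestrictLe (π := fun _ : ℕ ↦ 𝓨) t) :=
      measurable_iff_comap_le.2 (Filtration.piLE_eq_comap_frestrictLe (X := fun _ ↦ 𝓨) t).ge
    exact (measurable_pi_apply (⟨s, Finset.mem_Iic.2 hst⟩ : Finset.Iic t)).comp h1
  rintro (_ | i)
  · exact le_rfl
  · exact measurable_iff_comap_le.1 (hg.comp
      ((hmeas (a + i) (a + (i + 1)) (by omega)).prodMk (hmeas (a + i + 1) _ (by omega))))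

end MarkovLaw

/-! ### Strong law and large deviations for random walks -/

section RandomWalk

variable {Ω : Type*} {mΩ : MeasurableSpace Ω} {P : Measure Ω} {X : ℕ → Ω → ℝ}

theorem ae_tendsto_inv_mul_sum_range_succ {η : Measure ℝ} (hX : ∀ i, Measurable (X i))
    (hlaw : ∀ i, P.map (X i) = η) (hη : Integrable id η) (hind : iIndepFun X P) :
    ∀ᵐ ω ∂P, Tendsto (fun n : ℕ ↦ (n : ℝ)⁻¹ * ∑ i ∈ Finset.range (n + 1), X i ω) atTop
      (𝓝 (∫ x, x ∂η)) := by
  have hint : Integrable (X 0) P := by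
    rw [← hlaw 0] at hη
    exact (integrable_map_measure aestronglyMeasurable_id (hX 0).aemeasurable).1 hη
  have hmean : ∫ ω, X 0 ω ∂P = ∫ x, x ∂η := by
    rw [← hlaw 0, integral_map (hX 0).aemeasurable (by fun_prop)]
  have hlln := strong_law_ae_real X hint (fun i j hij ↦ hind.indepFun hij)
    fun i ↦ ⟨(hX i).aemeasurable, (hX 0).aemeasurable, by rw [hlaw, hlaw]⟩
  filter_upwards [hlln] with ω hω
  rw [hmean] at hω
  -- The strong law divides the `n + 1` terms by `n + 1`; the factor `1 + n⁻¹` restores the division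
  -- by `n`.
  have h1 := hω.comp (tendsto_add_atTop_nat 1)
  have h2 : Tendsto (fun n : ℕ ↦ (1 : ℝ) + (n : ℝ)⁻¹) atTop (𝓝 1) := by
    simpa using (tendsto_inv_atTop_nhds_zero_nat (𝕜 := ℝ)).const_add 1
  have h3 := h2.mul h1
  rw [one_mul] at h3
  refine h3.congr' ?_
  filter_upwards [eventually_gt_atTop 0] with n hn
  have hn' : (n : ℝ) ≠ 0 := by positivity
  simp only [Function.comp_apply, Nat.cast_add, Nat.cast_one]
  have : (n : ℝ) + 1 ≠ 0 := by positivity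
  field_simp

/-- A Chernoff bound, with a union bound, for the running maximum of a Gaussian random walk. -/
theorem measureReal_exists_lt_sum_range_le [IsProbabilityMeasure P] {I : ℝ} (hI : 0 ≤ I)
    (hX : ∀ i, Measurable (X i)) (hlaw : ∀ i, P.map (X i) = gaussianReal I (2 * I).toNNReal)
    (hind : iIndepFun X P) {δ : ℝ} (hδ : 0 ≤ δ) (n : ℕ) :
    P.real {ω | ∃ t ≤ n, I * (1 + δ) * n < ∑ i ∈ Finset.range (t + 1), X i ω} ≤
      ((n : ℝ) + 1) * Real.exp (I * (δ / 2 + δ ^ 2 / 4) - I * δ ^ 2 / 4 * n) := by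
  have hsub : {ω | ∃ t ≤ n, I * (1 + δ) * n < ∑ i ∈ Finset.range (t + 1), X i ω} ⊆
      ⋃ t ∈ Finset.range (n + 1),
        {ω | I * (1 + δ) * n ≤ (∑ i ∈ Finset.range (t + 1), X i) ω} := by
    rintro ω ⟨t, ht, hω⟩
    refine Set.mem_biUnion (Finset.mem_coe.2 (Finset.mem_range.2 (Nat.lt_succ_of_le ht))) ?_
    simpa using hω.le
  refine (measureReal_mono hsub (measure_ne_top _ _)).trans ((measureReal_biUnion_finset_le _ _).trans ?_)
  -- At `s` the log-mgf is `I (s + s²)`, so the exponent per step is `I (s² - s δ)`, minimal at `s =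
  -- δ / 2`. The term without `n` in the bound pays for the extra summand, as there are `n + 1` of
  -- them when `t = n`.
  have hmgf : ∀ i, mgf (X i) P (δ / 2) = Real.exp (I * (δ / 2 + δ ^ 2 / 4)) := fun i ↦ by
    rw [mgf_gaussianReal (hlaw i), Real.coe_toNNReal _ (by positivity)]
    congr 1; ring
  have hexp : ∀ i, Integrable (fun ω ↦ Real.exp (δ / 2 * X i ω)) P := fun i ↦ by
    have := integrable_exp_mul_gaussianReal (μ := I) (v := (2 * I).toNNReal) (δ / 2)
    rw [← hlaw i] at this
    exact (integrable_map_measure (by fun_prop) (hX i).aemeasurable).1 this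
  have hterm : ∀ t ∈ Finset.range (n + 1),
      P.real {ω | I * (1 + δ) * n ≤ (∑ i ∈ Finset.range (t + 1), X i) ω} ≤
        Real.exp (I * (δ / 2 + δ ^ 2 / 4) - I * δ ^ 2 / 4 * n) := fun t ht ↦ by
    refine (measure_ge_le_exp_mul_mgf _ (t := δ / 2) (by positivity)
      (hind.integrable_exp_mul_sum hX fun i _ ↦ hexp i)).trans ?_
    rw [hind.mgf_sum hX, Finset.prod_congr rfl fun i _ ↦ hmgf i, Finset.prod_const,
      Finset.card_range, ← Real.exp_nat_mul, ← Real.exp_add, Real.exp_le_exp]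
    have ht' : (t : ℝ) ≤ n := by exact_mod_cast Nat.lt_succ_iff.1 (Finset.mem_range.1 ht)
    have h1 : (t : ℝ) * (I * (δ / 2 + δ ^ 2 / 4)) ≤ n * (I * (δ / 2 + δ ^ 2 / 4)) := by gcongr
    push_cast
    linarith
  refine (Finset.sum_le_sum hterm).trans ?_
  simp

theorem tendsto_add_one_mul_exp_sub {a c : ℝ} (hc : 0 < c) :
    Tendsto (fun n : ℕ ↦ ((n : ℝ) + 1) * Real.exp (a - c * n)) atTop (𝓝 0) := by
  have h1 : Tendsto (fun x : ℝ ↦ x ^ 1 * Real.exp (-c * x)) atTop (𝓝 0) := by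
    simpa using tendsto_rpow_mul_exp_neg_mul_atTop_nhds_zero 1 c hc
  have h0 : Tendsto (fun x : ℝ ↦ x ^ 0 * Real.exp (-c * x)) atTop (𝓝 0) := by
    simpa using tendsto_rpow_mul_exp_neg_mul_atTop_nhds_zero 0 c hc
  have h := ((h1.add h0).const_mul (Real.exp a)).comp tendsto_natCast_atTop_atTop
  rw [add_zero, mul_zero] at h
  refine h.congr fun n ↦ ?_
  rw [sub_eq_add_neg, Real.exp_add]
  simp only [Function.comp_apply, neg_mul]
  ring

end RandomWalk

/-! ### Information rate from i.i.d. log-likelihood ratios -/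

section InformationRate

theorem changeKernel_of_le {𝓨 : Type*} [MeasurableSpace 𝓨] {κ₀ κ₁ : Kernel 𝓨 𝓨} {ν t : ℕ}
    (h : ν ≤ t + 1) : changeKernel κ₀ κ₁ ν t = κ₁ := by
  rw [changeKernel, if_neg (by omega)]

variable {𝓨 : Type*} [MeasurableSpace 𝓨] {μ : Measure 𝓨} [IsProbabilityMeasure μ]
  {κ₀ κ₁ : Kernel 𝓨 𝓨} [IsMarkovKernel κ₀] [IsMarkovKernel κ₁]

/-- The kernel of index `t` produces `Y_{t+1}`, so the transition into `Y_ν` has index `ν - 1`: the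
past stops there and the increments start there. -/
theorem changeLaw_iIndep (ν : ℕ) {g : 𝓨 → 𝓨 → ℝ}
    (hg : Measurable (Function.uncurry g)) {η : Measure ℝ} [SFinite η]
    (h : ∀ y, (κ₁ y).map (g y) = η) :
    iIndep (fun i : ℕ ↦ Nat.casesOn i (Filtration.piLE (X := fun _ : ℕ ↦ 𝓨) (ν - 1))
      (fun i ↦ MeasurableSpace.comap (fun ω : ℕ → 𝓨 ↦ g (ω (ν - 1 + i)) (ω (ν - 1 + i + 1)))
        inferInstance)) (changeLaw μ κ₀ κ₁ ν) :=
  markovLaw_iIndep hg fun t ht y ↦ by rw [changeKernel_of_le (by omega)]; exact h y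

theorem changeLaw_iIndepFun (ν : ℕ) {g : 𝓨 → 𝓨 → ℝ}
    (hg : Measurable (Function.uncurry g)) {η : Measure ℝ} [SFinite η]
    (h : ∀ y, (κ₁ y).map (g y) = η) :
    iIndepFun (fun (i : ℕ) (ω : ℕ → 𝓨) ↦ g (ω (ν - 1 + i)) (ω (ν - 1 + i + 1)))
      (changeLaw μ κ₀ κ₁ ν) := by
  rw [iIndepFun_iff_iIndep]
  exact (changeLaw_iIndep (μ := μ) (κ₀ := κ₀) ν hg h).precomp Nat.succ_injective

theorem changeLaw_map_increment {ν : ℕ} {g : 𝓨 → 𝓨 → ℝ}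
    (hg : Measurable (Function.uncurry g)) {η : Measure ℝ} [SFinite η]
    (h : ∀ y, (κ₁ y).map (g y) = η) (i : ℕ) :
    (changeLaw μ κ₀ κ₁ ν).map (fun ω ↦ g (ω (ν - 1 + i)) (ω (ν - 1 + i + 1))) = η :=
  markovLaw_map_increment hg fun y ↦ by rw [changeKernel_of_le (by omega)]; exact h y

/-- The increments after the change are independent of the observations before the change. -/
theorem changeLaw_indep (ν : ℕ) {g : 𝓨 → 𝓨 → ℝ}
    (hg : Measurable (Function.uncurry g)) {η : Measure ℝ} [SFinite η]
    (h : ∀ y, (κ₁ y).map (g y) = η) :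
    Indep (⨆ i : ℕ, MeasurableSpace.comap
        (fun ω : ℕ → 𝓨 ↦ g (ω (ν - 1 + i)) (ω (ν - 1 + i + 1))) inferInstance)
      (Filtration.piLE (X := fun _ : ℕ ↦ 𝓨) (ν - 1)) (changeLaw μ κ₀ κ₁ ν) := by
  have hle : ∀ i : ℕ, (Nat.casesOn i (Filtration.piLE (X := fun _ : ℕ ↦ 𝓨) (ν - 1))
      (fun i ↦ MeasurableSpace.comap (fun ω : ℕ → 𝓨 ↦ g (ω (ν - 1 + i)) (ω (ν - 1 + i + 1)))
        inferInstance) : MeasurableSpace (ℕ → 𝓨)) ≤ MeasurableSpace.pi := by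
    rintro (_ | i)
    · exact (Filtration.piLE (X := fun _ : ℕ ↦ 𝓨)).le _
    · exact measurable_iff_comap_le.1 (measurable_increment hg _)
  have h1 := indep_iSup_of_disjoint hle (changeLaw_iIndep (μ := μ) (κ₀ := κ₀) ν hg h)
    (S := {i | i ≠ 0}) (T := {0}) (by simp)
  refine indep_of_indep_of_le_left (indep_of_indep_of_le_right h1 ?_) ?_
  · simp
  · refine iSup_le fun i ↦ ?_
    exact le_iSup₂_of_le (i + 1) (Nat.succ_ne_zero i) le_rfl

variable [MeasurableSpace.CountableOrCountablyGenerated 𝓨 𝓨]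

/-- For `t ≥ ν` the law of `(Y_{t-1}, Y_t)` disintegrates along `κ₁`, so an identity valid `κ₁
y`-a.e. for each `y` holds along almost every path, for the countably many `t` at once. -/
theorem ae_changeLaw_rnDeriv_eq {g : 𝓨 → 𝓨 → ℝ}
    (hg : Measurable (Function.uncurry g))
    (hd : ∀ y, ∀ᵐ z ∂(κ₁ y), Kernel.rnDeriv κ₁ κ₀ y z = ENNReal.ofReal (Real.exp (g y z)))
    {ν : ℕ} (hν : 1 ≤ ν) :
    ∀ᵐ ω ∂(changeLaw μ κ₀ κ₁ ν), ∀ t, ν ≤ t →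
      Kernel.rnDeriv κ₁ κ₀ (ω (t - 1)) (ω t) = ENNReal.ofReal (Real.exp (g (ω (t - 1)) (ω t))) := by
  rw [ae_all_iff]
  intro t
  by_cases ht : ν ≤ t
  swap
  · exact ae_of_all _ fun ω h ↦ absurd h ht
  obtain ⟨s, rfl⟩ : ∃ s, t = s + 1 := ⟨t - 1, by omega⟩
  have hms : MeasurableSet {p : 𝓨 × 𝓨 |
      Kernel.rnDeriv κ₁ κ₀ p.1 p.2 = ENNReal.ofReal (Real.exp (g p.1 p.2))} :=
    measurableSet_eq_fun (Kernel.measurable_rnDeriv κ₁ κ₀)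
      (ENNReal.measurable_ofReal.comp (Real.measurable_exp.comp hg))
  have h1 : ∀ᵐ p ∂((changeLaw μ κ₀ κ₁ ν).map (fun ω ↦ (ω s, ω (s + 1)))),
      Kernel.rnDeriv κ₁ κ₀ p.1 p.2 = ENNReal.ofReal (Real.exp (g p.1 p.2)) := by
    have hmap : (changeLaw μ κ₀ κ₁ ν).map (fun ω ↦ (ω s, ω (s + 1))) =
        (changeLaw μ κ₀ κ₁ ν).map (fun ω ↦ ω s) ⊗ₘ κ₁ := by
      rw [changeLaw, markovLaw_map_pair, changeKernel_of_le ht]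
    have := Measure.isProbabilityMeasure_map (μ := changeLaw μ κ₀ κ₁ ν)
      (f := fun ω ↦ ω s) (measurable_pi_apply s).aemeasurable
    rw [hmap, Measure.ae_compProd_iff hms]
    exact ae_of_all _ hd
  filter_upwards [ae_of_ae_map (by fun_prop) h1] with ω hω _
  exact hω

/-- If, after the change, the log-likelihood ratios of every transition have the law `𝒩(I, 2I)`, then
`I` is the information rate. -/
theorem isInformationRate_of_map_eq_gaussianReal {g : 𝓨 → 𝓨 → ℝ}
    (hg : Measurable (Function.uncurry g))
    (hd : ∀ y, ∀ᵐ z ∂(κ₁ y), Kernel.rnDeriv κ₁ κ₀ y z = ENNReal.ofReal (Real.exp (g y z)))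
    {I : ℝ} (hI : 0 ≤ I) (h : ∀ y, (κ₁ y).map (g y) = gaussianReal I (2 * I).toNNReal) :
    IsInformationRate μ κ₀ κ₁ I := by
  have hX : ∀ ν i : ℕ, Measurable fun ω : ℕ → 𝓨 ↦ g (ω (ν - 1 + i)) (ω (ν - 1 + i + 1)) :=
    fun ν i ↦ measurable_increment hg _
  have hZ : ∀ ν : ℕ, 1 ≤ ν → ∀ᵐ ω ∂(changeLaw μ κ₀ κ₁ ν), ∀ n : ℕ,
      ∑ t ∈ Finset.Icc ν (ν + n), logLikelihoodRatio κ₀ κ₁ t ω =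
        ∑ i ∈ Finset.range (n + 1), g (ω (ν - 1 + i)) (ω (ν - 1 + i + 1)) := fun ν hν ↦ by
    filter_upwards [ae_changeLaw_rnDeriv_eq (μ := μ) hg hd hν] with ω hω n
    have hIcc : Finset.Icc ν (ν + n) = Finset.Ico ν (ν + (n + 1)) := by
      ext; simp; omega
    rw [hIcc, Finset.sum_Ico_eq_sum_range]
    refine Finset.sum_congr (by simp) fun i _ ↦ ?_
    rw [show ν - 1 + i + 1 = ν + i by omega, show ν - 1 + i = ν + i - 1 by omega]
    rw [logLikelihoodRatio, hω _ (by omega), ENNReal.toReal_ofReal (Real.exp_pos _).le,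
      Real.log_exp]
  refine ⟨fun ν hν ↦ ?_, fun ν hν ↦ ?_, fun δ hδ ↦ ?_⟩
  · filter_upwards [ae_changeLaw_rnDeriv_eq (μ := μ) hg hd hν] with ω hω t ht
    rw [hω t ht]
    exact ENNReal.ofReal_ne_top
  · have hlln := ae_tendsto_inv_mul_sum_range_succ (P := changeLaw μ κ₀ κ₁ ν) (hX ν)
      (changeLaw_map_increment hg h)
      ((memLp_id_gaussianReal 1).integrable (by simp)) (changeLaw_iIndepFun ν hg h)
    rw [integral_id_gaussianReal] at hlln
    filter_upwards [hlln, hZ ν hν] with ω hω hZω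
    simpa only [hZω] using hω
  -- Up to a null set the event depends only on the increments after the change, so its conditional
  -- probability given the past is its probability, and the essential supremum is that of a
  -- constant.
  · have hcond : ∀ n ν : ℕ, 1 ≤ ν →
        essSup (fun ω ↦ ENNReal.ofReal
          (((changeLaw μ κ₀ κ₁ ν)⟦{ω' | ∃ t ≤ n, I * (1 + δ) * n <
              ∑ i ∈ Finset.Icc ν (ν + t), logLikelihoodRatio κ₀ κ₁ i ω'} |
            Filtration.piLE (X := fun _ ↦ 𝓨) (ν - 1)⟧) ω)) (changeLaw μ κ₀ κ₁ ν) =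
        ENNReal.ofReal ((changeLaw μ κ₀ κ₁ ν).real {ω | ∃ t ≤ n, I * (1 + δ) * n <
          ∑ i ∈ Finset.range (t + 1), g (ω (ν - 1 + i)) (ω (ν - 1 + i + 1))}) := fun n ν hν ↦ by
      set S := {ω : ℕ → 𝓨 | ∃ t ≤ n, I * (1 + δ) * n <
          ∑ i ∈ Finset.range (t + 1), g (ω (ν - 1 + i)) (ω (ν - 1 + i + 1))} with hS
      have hmX : ∀ i, Measurable[⨆ i : ℕ, MeasurableSpace.comap
          (fun ω : ℕ → 𝓨 ↦ g (ω (ν - 1 + i)) (ω (ν - 1 + i + 1))) inferInstance]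
          fun ω : ℕ → 𝓨 ↦ g (ω (ν - 1 + i)) (ω (ν - 1 + i + 1)) := fun i ↦
        measurable_iff_comap_le.2 (le_iSup (fun i : ℕ ↦ MeasurableSpace.comap
          (fun ω : ℕ → 𝓨 ↦ g (ω (ν - 1 + i)) (ω (ν - 1 + i + 1))) inferInstance) i)
      have hSm : MeasurableSet[⨆ i : ℕ, MeasurableSpace.comap
          (fun ω : ℕ → 𝓨 ↦ g (ω (ν - 1 + i)) (ω (ν - 1 + i + 1))) inferInstance] S := by
        have : S = ⋃ t ∈ Finset.range (n + 1), {ω : ℕ → 𝓨 | I * (1 + δ) * n <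
          ∑ i ∈ Finset.range (t + 1), g (ω (ν - 1 + i)) (ω (ν - 1 + i + 1))} := by
          ext ω; simp [hS]
        rw [this]
        exact Finset.measurableSet_biUnion _ fun t _ ↦ measurableSet_lt measurable_const
          (Finset.measurable_sum _ fun i _ ↦ hmX i)
      have hle1 : (⨆ i : ℕ, MeasurableSpace.comap
          (fun ω : ℕ → 𝓨 ↦ g (ω (ν - 1 + i)) (ω (ν - 1 + i + 1))) inferInstance) ≤
          MeasurableSpace.pi :=
        iSup_le fun i ↦ measurable_iff_comap_le.1 (hX ν i)
      have hae : {ω' | ∃ t ≤ n, I * (1 + δ) * n <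
          ∑ i ∈ Finset.Icc ν (ν + t), logLikelihoodRatio κ₀ κ₁ i ω'} =ᵐ[changeLaw μ κ₀ κ₁ ν] S := by
        refine eventuallyEq_set.2 ?_
        filter_upwards [hZ ν hν] with ω hω
        simp only [hS, Set.mem_ofPred_eq, hω]
      have hce : ((changeLaw μ κ₀ κ₁ ν)⟦{ω' | ∃ t ≤ n, I * (1 + δ) * n <
              ∑ i ∈ Finset.Icc ν (ν + t), logLikelihoodRatio κ₀ κ₁ i ω'} |
            Filtration.piLE (X := fun _ ↦ 𝓨) (ν - 1)⟧) =ᵐ[changeLaw μ κ₀ κ₁ ν]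
          fun _ ↦ (changeLaw μ κ₀ κ₁ ν).real S := by
        refine (condExp_congr_ae (indicator_ae_eq_of_ae_eq_set hae)).trans ?_
        refine (condExp_indep_eq hle1 ((Filtration.piLE (X := fun _ : ℕ ↦ 𝓨)).le _)
          (stronglyMeasurable_const.indicator hSm) (changeLaw_indep ν hg h)).trans ?_
        rw [integral_indicator_const _ (hle1 _ hSm)]
        simp
      exact (essSup_congr_ae (hce.fun_comp ENNReal.ofReal)).trans
        (essSup_const _ (IsProbabilityMeasure.ne_zero _))
    -- For `I = 0` the Chernoff bound does not decay. But then the increments have law `𝒩(0, 0)`, so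
    -- all sums vanish almost surely and the strict inequality `0 < 0` fails.
    rcases hI.eq_or_lt with rfl | hIpos
    · refine tendsto_const_nhds.congr fun n ↦ ?_
      symm
      simp only [ENNReal.iSup_eq_zero]
      intro ν hν
      rw [hcond n ν hν]
      have hzero : ∀ᵐ ω ∂(changeLaw μ κ₀ κ₁ ν), ∀ i : ℕ,
          g (ω (ν - 1 + i)) (ω (ν - 1 + i + 1)) = 0 := by
        rw [ae_all_iff]
        intro i
        have := changeLaw_map_increment (μ := μ) (κ₀ := κ₀) (ν := ν) hg h i
        rw [mul_zero, Real.toNNReal_zero, gaussianReal_zero_var] at this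
        have h0 : ∀ᵐ x ∂(Measure.dirac (0 : ℝ)), x = 0 := by simp [ae_dirac_eq]
        rw [← this] at h0
        exact ae_of_ae_map (hX ν i).aemeasurable h0
      rw [ENNReal.ofReal_eq_zero]
      refine le_of_eq ((measureReal_eq_zero_iff).2 ?_)
      rw [measure_eq_zero_iff_ae_notMem]
      filter_upwards [hzero] with ω hω
      simp [hω]
    -- The bound is free of `ν`, so it survives the supremum.
    · have hlim := ENNReal.tendsto_ofReal (tendsto_add_one_mul_exp_sub
        (a := I * (δ / 2 + δ ^ 2 / 4)) (c := I * δ ^ 2 / 4) (by positivity))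
      rw [ENNReal.ofReal_zero] at hlim
      refine tendsto_of_tendsto_of_tendsto_of_le_of_le tendsto_const_nhds hlim
        (fun _ ↦ bot_le) fun n ↦ iSup₂_le fun ν hν ↦ ?_
      rw [hcond n ν hν]
      exact ENNReal.ofReal_le_ofReal (measureReal_exists_lt_sum_range_le hI (hX ν)
        (changeLaw_map_increment hg h) (changeLaw_iIndepFun ν hg h) hδ.le n)

end InformationRate

/-! ### Integrals, densities and sums on composition products -/

section CompProd

variable {α β : Type*} [MeasurableSpace α] [MeasurableSpace β]

theorem integral_bind_of_integrable {E : Type*} [NormedAddCommGroup E] [NormedSpace ℝ E]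
    {μ : Measure α} [SFinite μ] {κ : Kernel α β} [IsMarkovKernel κ] {f : β → E}
    (hf : Integrable f (μ.bind κ)) : ∫ y, f y ∂(μ.bind κ) = ∫ x, ∫ y, f y ∂(κ x) ∂μ := by
  rw [← Measure.snd_compProd, Measure.snd] at hf ⊢
  rw [integral_map (by fun_prop) hf.aestronglyMeasurable]
  exact Measure.integral_compProd (hf.comp_measurable measurable_snd)

theorem withDensity_compProd_withDensity {μ : Measure α} [SFinite μ] {κ κ' : Kernel α β}
    [IsMarkovKernel κ] [IsMarkovKernel κ'] {f : α → ENNReal} (hf : Measurable f)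
    [SFinite (μ.withDensity f)]
    {g : α → β → ENNReal} (hg : Measurable (Function.uncurry g))
    (h : ∀ x, κ' x = (κ x).withDensity (g x)) :
    μ.withDensity f ⊗ₘ κ' = (μ ⊗ₘ κ).withDensity (fun p ↦ f p.1 * g p.1 p.2) := by
  have hg' : Measurable fun p : α × β ↦ g p.1 p.2 := hg
  have hfg : Measurable fun p : α × β ↦ f p.1 * g p.1 p.2 := (hf.comp measurable_fst).mul hg'
  ext s hs
  rw [Measure.compProd_apply hs, withDensity_apply _ hs, ← lintegral_indicator hs,
    Measure.lintegral_compProd (hfg.indicator hs),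
    lintegral_withDensity_eq_lintegral_mul _ hf (Kernel.measurable_kernel_prodMk_left hs)]
  refine lintegral_congr fun x ↦ ?_
  have hs' : MeasurableSet (Prod.mk x ⁻¹' s) := measurable_prodMk_left hs
  have hgx : Measurable (g x) := hg.comp measurable_prodMk_left
  rw [Pi.mul_apply, h x, withDensity_apply _ hs', ← lintegral_indicator hs',
    ← lintegral_const_mul _ (hgx.indicator hs')]
  refine lintegral_congr fun y ↦ ?_
  by_cases hy : (x, y) ∈ s
  · rw [Set.indicator_of_mem hy, Set.indicator_of_mem (show y ∈ Prod.mk x ⁻¹' s from hy)]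
  · rw [Set.indicator_of_notMem hy, Set.indicator_of_notMem (show y ∉ Prod.mk x ⁻¹' s from hy),
      mul_zero]

/-- By `map_compProd_of_map_eq` the two summands are independent, so their laws convolve. -/
theorem map_add_compProd_of_map_eq {μ : Measure α} [SFinite μ] {κ : Kernel α β}
    [IsMarkovKernel κ] {f : α → ℝ} (hf : Measurable f) {g : α → β → ℝ}
    (hg : Measurable (Function.uncurry g)) {η : Measure ℝ} [SFinite η]
    (h : ∀ x, (κ x).map (g x) = η) :
    (μ ⊗ₘ κ).map (fun p ↦ f p.1 + g p.1 p.2) = (μ.map f) ∗ η := by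
  have hg' : Measurable fun p : α × β ↦ g p.1 p.2 := hg
  have h1 := congrArg (Measure.map fun q : α × ℝ ↦ f q.1 + q.2)
    (map_compProd_of_map_eq (μ := μ) hg h)
  rw [Measure.map_map (by fun_prop) (measurable_fst.prodMk hg')] at h1
  have h2 : (μ.map f).prod η = (μ.prod η).map (Prod.map f id) := by
    rw [← Measure.map_prod_map _ _ hf measurable_id, Measure.map_id]
  rw [Measure.conv, h2, Measure.map_map (by fun_prop) (by fun_prop)]
  exact h1

end CompProd

/-! ### Multivariate Gaussian measures, possibly degenerate -/

section Gaussian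

variable {n p : ℕ}

theorem EuclideanSpace.real_inner_eq_dotProduct (x y : EuclideanSpace ℝ (Fin n)) :
    inner ℝ x y = x.ofLp ⬝ᵥ y.ofLp := by
  rw [EuclideanSpace.inner_eq_star_dotProduct, star_trivial, dotProduct_comm]

theorem integral_cexp_dotProduct_multivariateGaussian (m : EuclideanSpace ℝ (Fin n))
    {S : Matrix (Fin n) (Fin n) ℝ} (hS : S.PosSemidef) (t : Fin n → ℝ) :
    ∫ x, Complex.exp ((t ⬝ᵥ x.ofLp : ℝ) * Complex.I) ∂(multivariateGaussian m S) =
      Complex.exp ((t ⬝ᵥ m.ofLp : ℝ) * Complex.I - (t ⬝ᵥ S *ᵥ t : ℝ) / 2) := by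
  have h := charFun_multivariateGaussian (μ := m) hS (WithLp.toLp 2 t)
  rw [charFun_apply, EuclideanSpace.real_inner_eq_dotProduct] at h
  rw [← h]
  refine integral_congr_ae (ae_of_all _ fun x ↦ ?_)
  simp only [EuclideanSpace.real_inner_eq_dotProduct, dotProduct_comm t]

theorem integrable_cexp_ofReal_mul_I {Ω : Type*} [MeasurableSpace Ω] {P : Measure Ω}
    [IsFiniteMeasure P] {f : Ω → ℝ} (hf : Measurable f) :
    Integrable (fun x ↦ Complex.exp (f x * Complex.I)) P := by
  refine (integrable_const (1 : ℝ)).mono' (by fun_prop) (ae_of_all _ fun x ↦ ?_)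
  rw [Complex.norm_exp_ofReal_mul_I]

theorem ext_of_integral_cexp_dotProduct {μ μ' : Measure (EuclideanSpace ℝ (Fin n))}
    [IsFiniteMeasure μ] [IsFiniteMeasure μ']
    (h : ∀ t : Fin n → ℝ, ∫ x, Complex.exp ((t ⬝ᵥ x.ofLp : ℝ) * Complex.I) ∂μ =
      ∫ x, Complex.exp ((t ⬝ᵥ x.ofLp : ℝ) * Complex.I) ∂μ') : μ = μ' := by
  refine Measure.ext_of_charFun (funext fun t ↦ ?_)
  simpa only [charFun_apply, EuclideanSpace.real_inner_eq_dotProduct, dotProduct_comm t.ofLp]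
    using h t.ofLp

theorem gaussianKernel_apply {𝓨 : Type*} [MeasurableSpace 𝓨]
    (f : 𝓨 → EuclideanSpace ℝ (Fin n)) (hf : Measurable f) (S : Matrix (Fin n) (Fin n) ℝ) (y : 𝓨) :
    gaussianKernel f hf S y = multivariateGaussian (f y) S := rfl

/-- The characteristic function of the kernel at `t` is an exponential in `(Mᵀ t) ⬝ᵥ x`, so
integrating it evaluates that of the input at `Mᵀ t`. Covariances may be singular: the state chain
starts at a point. -/
theorem multivariateGaussian_bind_gaussianKernel (m : EuclideanSpace ℝ (Fin n))
    {S : Matrix (Fin n) (Fin n) ℝ} (hS : S.PosSemidef) {W : Matrix (Fin p) (Fin p) ℝ}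
    (hW : W.PosSemidef) (M : Matrix (Fin p) (Fin n) ℝ) (c : Fin p → ℝ)
    {f : EuclideanSpace ℝ (Fin n) → EuclideanSpace ℝ (Fin p)} (hf : Measurable f)
    (hfM : ∀ x, (f x).ofLp = M *ᵥ x.ofLp + c) :
    (multivariateGaussian m S).bind (gaussianKernel f hf W) =
      multivariateGaussian (f m) (M * S * Mᵀ + W) := by
  have hMS : (M * S * Mᵀ).PosSemidef := by
    simpa [conjTranspose_eq_transpose_of_trivial] using hS.mul_mul_conjTranspose_same M
  refine ext_of_integral_cexp_dotProduct fun t ↦ ?_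
  rw [integral_bind_of_integrable (integrable_cexp_ofReal_mul_I (by fun_prop)),
    integral_cexp_dotProduct_multivariateGaussian _ (hMS.add hW)]
  have h1 : ∀ x : EuclideanSpace ℝ (Fin n), ∫ y, Complex.exp ((t ⬝ᵥ y.ofLp : ℝ) * Complex.I)
      ∂(gaussianKernel f hf W x) =
      Complex.exp (((Mᵀ *ᵥ t) ⬝ᵥ x.ofLp : ℝ) * Complex.I) *
        Complex.exp ((t ⬝ᵥ c : ℝ) * Complex.I - (t ⬝ᵥ W *ᵥ t : ℝ) / 2) := fun x ↦ by
    rw [gaussianKernel_apply, integral_cexp_dotProduct_multivariateGaussian _ hW, hfM,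
      ← Complex.exp_add, dotProduct_add, mulVec_transpose, dotProduct_mulVec]
    push_cast
    ring_nf
  simp_rw [h1]
  rw [integral_mul_const, integral_cexp_dotProduct_multivariateGaussian _ hS, ← Complex.exp_add,
    hfM, dotProduct_add, mulVec_transpose, ← dotProduct_mulVec, add_mulVec, dotProduct_add]
  have h2 : t ⬝ᵥ (M * S * Mᵀ) *ᵥ t = t ⬝ᵥ M *ᵥ (S *ᵥ (t ᵥ* M)) := by
    rw [← mulVec_transpose M t, mulVec_mulVec, mulVec_mulVec, Matrix.mul_assoc]
  rw [h2, ← dotProduct_mulVec]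
  push_cast
  ring_nf

theorem dirac_eq_multivariateGaussian (x : EuclideanSpace ℝ (Fin n)) :
    Measure.dirac x = multivariateGaussian x 0 := by
  simp [multivariateGaussian]

theorem multivariateGaussian_map_dotProduct_add (m : EuclideanSpace ℝ (Fin n))
    {S : Matrix (Fin n) (Fin n) ℝ} (hS : S.PosSemidef) (v : Fin n → ℝ) (c : ℝ) :
    (multivariateGaussian m S).map (fun x ↦ v ⬝ᵥ x.ofLp + c) =
      gaussianReal (v ⬝ᵥ m.ofLp + c) (v ⬝ᵥ S *ᵥ v).toNNReal := by
  have hv : 0 ≤ v ⬝ᵥ S *ᵥ v := by simpa using hS.dotProduct_mulVec_nonneg v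
  have := Measure.isProbabilityMeasure_map (μ := multivariateGaussian m S)
    (f := fun x ↦ v ⬝ᵥ x.ofLp + c) (by fun_prop)
  refine Measure.ext_of_charFun (funext fun t ↦ ?_)
  rw [charFun_gaussianReal, charFun_apply_real, integral_map (by fun_prop) (by fun_prop)]
  have h1 : ∀ x : EuclideanSpace ℝ (Fin n),
      Complex.exp (t * ((v ⬝ᵥ x.ofLp + c : ℝ) : ℂ) * Complex.I) =
        Complex.exp (((t • v) ⬝ᵥ x.ofLp : ℝ) * Complex.I) * Complex.exp (t * c * Complex.I) :=
    fun x ↦ by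
      rw [← Complex.exp_add, smul_dotProduct, smul_eq_mul]
      push_cast
      ring_nf
  simp_rw [h1]
  rw [integral_mul_const, integral_cexp_dotProduct_multivariateGaussian _ hS, ← Complex.exp_add,
    Real.coe_toNNReal _ hv, mulVec_smul, smul_dotProduct, smul_dotProduct, dotProduct_smul]
  simp only [smul_eq_mul]
  push_cast
  ring_nf

theorem integrable_exp_dotProduct_multivariateGaussian (m : EuclideanSpace ℝ (Fin n))
    {S : Matrix (Fin n) (Fin n) ℝ} (hS : S.PosSemidef) (v : Fin n → ℝ) (c : ℝ) :
    Integrable (fun x ↦ Real.exp (v ⬝ᵥ x.ofLp + c)) (multivariateGaussian m S) := by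
  have h := integrable_exp_mul_gaussianReal (μ := v ⬝ᵥ m.ofLp + c)
    (v := (v ⬝ᵥ S *ᵥ v).toNNReal) 1
  rw [← multivariateGaussian_map_dotProduct_add m hS v c] at h
  simpa [Function.comp_def] using (integrable_map_measure (by fun_prop) (by fun_prop)).1 h

theorem integral_exp_dotProduct_multivariateGaussian (m : EuclideanSpace ℝ (Fin n))
    {S : Matrix (Fin n) (Fin n) ℝ} (hS : S.PosSemidef) (v : Fin n → ℝ) (c : ℝ) :
    ∫ x, Real.exp (v ⬝ᵥ x.ofLp + c) ∂(multivariateGaussian m S) =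
      Real.exp (v ⬝ᵥ m.ofLp + c + v ⬝ᵥ S *ᵥ v / 2) := by
  have hv : 0 ≤ v ⬝ᵥ S *ᵥ v := by simpa using hS.dotProduct_mulVec_nonneg v
  have h := mgf_gaussianReal (multivariateGaussian_map_dotProduct_add m hS v c) 1
  rw [Real.coe_toNNReal _ hv] at h
  simpa [mgf] using h

/-- An everywhere finite mgf extends analytically to the complex plane and so determines the law. -/
theorem map_eq_of_mgf_eq {Ω Ω' : Type*} [MeasurableSpace Ω] [MeasurableSpace Ω'] {P : Measure Ω}
    {P' : Measure Ω'} [IsProbabilityMeasure P] [IsProbabilityMeasure P'] {X : Ω → ℝ} {Y : Ω' → ℝ}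
    (hX : AEMeasurable X P) (hY : AEMeasurable Y P') (h : mgf X P = mgf Y P')
    (hint : integrableExpSet X P = Set.univ) : P.map X = P'.map Y := by
  refine Measure.ext_of_complexMGF_eq hX hY (funext fun z ↦ eqOn_complexMGF_of_mgf h ?_)
  simp [hint]

/-- The Cameron-Martin formula. -/
theorem multivariateGaussian_add_eq_withDensity (m : EuclideanSpace ℝ (Fin n))
    {S : Matrix (Fin n) (Fin n) ℝ} (hS : S.PosSemidef) (h : Fin n → ℝ) :
    multivariateGaussian (m + WithLp.toLp 2 (S *ᵥ h)) S =
      (multivariateGaussian m S).withDensity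
        (fun x ↦ ENNReal.ofReal (Real.exp (h ⬝ᵥ x.ofLp - h ⬝ᵥ m.ofLp - h ⬝ᵥ S *ᵥ h / 2))) := by
  have hsplit : ∀ x : EuclideanSpace ℝ (Fin n), h ⬝ᵥ x.ofLp - h ⬝ᵥ m.ofLp - h ⬝ᵥ S *ᵥ h / 2 =
      h ⬝ᵥ x.ofLp + (-(h ⬝ᵥ m.ofLp) - h ⬝ᵥ S *ᵥ h / 2) := fun x ↦ by ring
  simp_rw [hsplit]
  set N := multivariateGaussian m S with hN
  set c := -(h ⬝ᵥ m.ofLp) - h ⬝ᵥ S *ᵥ h / 2 with hc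
  set P := N.withDensity (fun x ↦ ENNReal.ofReal (Real.exp (h ⬝ᵥ x.ofLp + c))) with hP
  have hmeas : Measurable fun x : EuclideanSpace ℝ (Fin n) ↦
      ENNReal.ofReal (Real.exp (h ⬝ᵥ x.ofLp + c)) := by fun_prop
  have hprob : IsProbabilityMeasure P := by
    refine ⟨?_⟩
    rw [hP, withDensity_apply _ MeasurableSet.univ, Measure.restrict_univ, ← ofReal_integral_eq_lintegral_ofReal
      (integrable_exp_dotProduct_multivariateGaussian m hS h c)
      (ae_of_all _ fun x ↦ (Real.exp_pos _).le), integral_exp_dotProduct_multivariateGaussian m hS,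
      hc, show h ⬝ᵥ m.ofLp + (-(h ⬝ᵥ m.ofLp) - h ⬝ᵥ S *ᵥ h / 2) + h ⬝ᵥ S *ᵥ h / 2 = 0 by ring]
    simp
  have hmul : ∀ (v : Fin n → ℝ) (s : ℝ) (x : EuclideanSpace ℝ (Fin n)),
      (ENNReal.ofReal (Real.exp (h ⬝ᵥ x.ofLp + c))).toReal • Real.exp (s * (v ⬝ᵥ x.ofLp)) =
        Real.exp ((h + s • v) ⬝ᵥ x.ofLp + c) := fun v s x ↦ by
    rw [ENNReal.toReal_ofReal (Real.exp_pos _).le, smul_eq_mul, ← Real.exp_add, add_dotProduct,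
      smul_dotProduct, smul_eq_mul]
    ring_nf
  have hsymm : ∀ v : Fin n → ℝ, v ⬝ᵥ S *ᵥ h = h ⬝ᵥ S *ᵥ v := fun v ↦ by
    have hT : Sᵀ = S := by
      simpa [conjTranspose_eq_transpose_of_trivial] using hS.isHermitian.eq
    rw [dotProduct_mulVec, ← mulVec_transpose, hT, dotProduct_comm]
  -- Cramér-Wold: it suffices to compare one-dimensional projections. Under the tilt, the mgf of `v
  -- ⬝ᵥ x` at `s` becomes a Gaussian exponential integral in direction `h + s • v`. No Lebesgue
  -- density is needed, so `S` may be singular.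
  have hmap : ∀ v : Fin n → ℝ, P.map (fun x ↦ v ⬝ᵥ x.ofLp) =
      (multivariateGaussian (m + WithLp.toLp 2 (S *ᵥ h)) S).map (fun x ↦ v ⬝ᵥ x.ofLp) := fun v ↦ by
    refine map_eq_of_mgf_eq (by fun_prop) (by fun_prop) (funext fun s ↦ ?_)
      (Set.eq_univ_of_forall fun s ↦ ?_)
    · have h1 := integral_exp_dotProduct_multivariateGaussian
        (m + WithLp.toLp 2 (S *ᵥ h)) hS (s • v) 0
      simp only [add_zero, smul_dotProduct, smul_eq_mul] at h1
      rw [mgf, mgf, h1, hP, integral_withDensity_eq_integral_toReal_smul hmeas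
        (ae_of_all _ fun x ↦ ENNReal.ofReal_lt_top)]
      simp_rw [hmul]
      rw [integral_exp_dotProduct_multivariateGaussian m hS]
      simp only [add_dotProduct, smul_dotProduct, mulVec_add, mulVec_smul, dotProduct_add,
        dotProduct_smul, smul_eq_mul, hsymm, WithLp.ofLp_add, hc]
      ring_nf
    · rw [integrableExpSet, Set.mem_ofPred_eq, hP,
        integrable_withDensity_iff_integrable_smul' hmeas
          (ae_of_all _ fun x ↦ ENNReal.ofReal_lt_top)]
      simp_rw [hmul]
      exact integrable_exp_dotProduct_multivariateGaussian m hS _ _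
  refine ext_of_integral_cexp_dotProduct fun t ↦ ?_
  have h2 : ∀ P' : Measure (EuclideanSpace ℝ (Fin n)),
      ∫ x, Complex.exp ((t ⬝ᵥ x.ofLp : ℝ) * Complex.I) ∂P' =
        ∫ r : ℝ, Complex.exp (r * Complex.I) ∂(P'.map (fun x ↦ t ⬝ᵥ x.ofLp)) := fun P' ↦ by
    rw [integral_map (by fun_prop) (by fun_prop)]
  rw [h2, h2, hmap]

theorem integrable_sq_eval_multivariateGaussian (m : EuclideanSpace ℝ (Fin n))
    (S : Matrix (Fin n) (Fin n) ℝ) (i : Fin n) :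
    Integrable (fun x : EuclideanSpace ℝ (Fin n) ↦ x.ofLp i * x.ofLp i)
      (multivariateGaussian m S) := by
  have h : MemLp (fun x : EuclideanSpace ℝ (Fin n) ↦ x.ofLp i) 2 (multivariateGaussian m S) :=
    (EuclideanSpace.proj (𝕜 := ℝ) i).comp_memLp' IsGaussian.memLp_two_id
  exact h.integrable_mul h

theorem integral_dotProduct_self_multivariateGaussian (m : EuclideanSpace ℝ (Fin n))
    {S : Matrix (Fin n) (Fin n) ℝ} (hS : S.PosSemidef) :
    ∫ x : EuclideanSpace ℝ (Fin n), x.ofLp ⬝ᵥ x.ofLp ∂(multivariateGaussian m S) =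
      m.ofLp ⬝ᵥ m.ofLp + S.trace := by
  simp only [dotProduct, Matrix.trace, diag_apply]
  rw [integral_finsetSum _ fun i _ ↦ integrable_sq_eval_multivariateGaussian m S i,
    ← Finset.sum_add_distrib]
  refine Finset.sum_congr rfl fun i _ ↦ ?_
  have h : MemLp (fun x : EuclideanSpace ℝ (Fin n) ↦ x.ofLp i) 2 (multivariateGaussian m S) :=
    (EuclideanSpace.proj (𝕜 := ℝ) i).comp_memLp' IsGaussian.memLp_two_id
  have hmean : ∫ x : EuclideanSpace ℝ (Fin n), x.ofLp i ∂(multivariateGaussian m S) = m.ofLp i := by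
    have := (EuclideanSpace.proj (𝕜 := ℝ) i).integral_comp_id_comm
      (IsGaussian.integrable_id (μ := multivariateGaussian m S))
    simpa using this
  have hvar := variance_eval_multivariateGaussian (μ := m) hS i
  rw [variance_eq_sub h, hmean] at hvar
  simp only [Pi.pow_apply] at hvar
  simp only [← pow_two]
  linarith

end Gaussian

/-! ### Reduction to the state chain; uniqueness of values and rates -/

section StateProcess

variable {𝓧 𝓤 : Type*} [MeasurableSpace 𝓧] [MeasurableSpace 𝓤]

/-- The control is drawn afresh from the new state, so the pair law always has the form `μ ⊗ₘ π` and
only the state law has to be tracked. -/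
theorem MDP.compProd_bind_pairKernel (M : MDP 𝓧 𝓤) (π : Kernel 𝓧 𝓤) [IsMarkovKernel π]
    (μ : Measure 𝓧) [IsProbabilityMeasure μ] :
    (μ ⊗ₘ π).bind (M.pairKernel π) = (μ.bind (M.stateKernel π)) ⊗ₘ π := by
  have h1 : μ.bind (M.stateKernel π) = (μ ⊗ₘ π).bind M.trans := by
    rw [MDP.stateKernel, Measure.compProd_eq_comp_prod, Measure.comp_assoc]
  rw [h1]
  ext s hs
  rw [Measure.bind_apply hs (Kernel.aemeasurable _), Measure.compProd_apply hs,
    Measure.lintegral_bind (Kernel.aemeasurable _)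
      (Kernel.measurable_kernel_prodMk_left hs).aemeasurable]
  refine lintegral_congr fun y ↦ ?_
  rw [MDP.pairKernel, Kernel.compProd_apply hs]
  rfl

theorem MDP.markovLaw_map_eval (M : MDP 𝓧 𝓤) (π : Kernel 𝓧 𝓤) [IsMarkovKernel π]
    (μ : ℕ → Measure 𝓧) [∀ t, IsProbabilityMeasure (μ t)]
    (h : ∀ t, (μ t).bind (M.stateKernel π) = μ (t + 1)) (t : ℕ) :
    (markovLaw (μ 0 ⊗ₘ π) (fun _ ↦ M.pairKernel π)).map (fun ω ↦ ω t) = μ t ⊗ₘ π := by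
  induction t with
  | zero => exact markovLaw_map_zero
  | succ t ih => rw [markovLaw_map_succ, ih, MDP.compProd_bind_pairKernel, h]

theorem MDP.IsValue.unique [Nonempty 𝓧] {M : MDP 𝓧 𝓤} {π : Kernel 𝓧 𝓤} [IsMarkovKernel π]
    {v w : ℝ} (hv : M.IsValue π v) (hw : M.IsValue π w) : v = w :=
  tendsto_nhds_unique (hv (Classical.arbitrary 𝓧)).2 (hw (Classical.arbitrary 𝓧)).2

variable [MeasurableSpace.CountableOrCountablyGenerated (𝓧 × 𝓤) (𝓧 × 𝓤)]

theorem IsInformationRate.unique {𝓨 : Type*} [MeasurableSpace 𝓨]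
    [MeasurableSpace.CountableOrCountablyGenerated 𝓨 𝓨] {μ : Measure 𝓨} [IsProbabilityMeasure μ]
    {κ₀ κ₁ : Kernel 𝓨 𝓨} [IsMarkovKernel κ₀] [IsMarkovKernel κ₁] {I J : ℝ}
    (hI : IsInformationRate μ κ₀ κ₁ I) (hJ : IsInformationRate μ κ₀ κ₁ J) : I = J := by
  obtain ⟨ω, h1, h2⟩ := ((hI.2.1 1 le_rfl).and (hJ.2.1 1 le_rfl)).exists
  exact tendsto_nhds_unique h1 h2

/-- The existence clause supplies an invariant law at which to compare; without it the condition on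
all invariant laws could be vacuous. -/
theorem IsFullInformationRate.unique {M₀ M₁ : MDP 𝓧 𝓤} {π₀ π₁ : Kernel 𝓧 𝓤} [IsMarkovKernel π₀]
    [IsMarkovKernel π₁] {I J : ℝ} (hI : IsFullInformationRate M₀ M₁ π₀ π₁ I)
    (hJ : IsFullInformationRate M₀ M₁ π₀ π₁ J) : I = J := by
  obtain ⟨⟨μ, hμ, hinv⟩, h⟩ := hI
  exact (h μ hinv).unique (hJ.2 μ hinv)

theorem IsUtilityPrivacyValue.unique [Nonempty 𝓧] {M₀ M₁ : MDP 𝓧 𝓤} {ρ lam : ℝ}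
    {π₀ π₁ : Kernel 𝓧 𝓤} [IsMarkovKernel π₀] [IsMarkovKernel π₁] {v w : ℝ}
    (hv : IsUtilityPrivacyValue M₀ M₁ ρ lam π₀ π₁ v)
    (hw : IsUtilityPrivacyValue M₀ M₁ ρ lam π₀ π₁ w) : v = w := by
  obtain ⟨v₀, v₁, I, hv₀, hv₁, hI, rfl⟩ := hv
  obtain ⟨w₀, w₁, J, hw₀, hw₁, hJ, rfl⟩ := hw
  rw [hv₀.unique hw₀, hv₁.unique hw₁, hI.unique hJ]

end StateProcess

/-! ### Values and information rate of the linear system -/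

section LinearSystems

theorem ae_rnDeriv_eq_of_eq_withDensity {𝓨 : Type*} [MeasurableSpace 𝓨]
    [MeasurableSpace.CountableOrCountablyGenerated 𝓨 𝓨]
    {κ₀ κ₁ : Kernel 𝓨 𝓨} [IsMarkovKernel κ₀] [IsMarkovKernel κ₁] {y : 𝓨} {g : 𝓨 → ℝ}
    (hg : Measurable g)
    (hd : κ₁ y = (κ₀ y).withDensity (fun z ↦ ENNReal.ofReal (Real.exp (g z)))) :
    ∀ᵐ z ∂(κ₁ y), Kernel.rnDeriv κ₁ κ₀ y z = ENNReal.ofReal (Real.exp (g z)) := by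
  have hac : κ₁ y ≪ κ₀ y := by
    rw [hd]; exact withDensity_absolutelyContinuous _ _
  have h := Measure.rnDeriv_withDensity (κ₀ y)
    (ENNReal.measurable_ofReal.comp (Real.measurable_exp.comp hg))
  refine hac.ae_le (Kernel.rnDeriv_eq_rnDeriv_measure.trans ?_)
  rw [hd]
  exact h

variable {n m : ℕ} {A : Matrix (Fin n) (Fin n) ℝ} {B : Matrix (Fin n) (Fin m) ℝ}
  {Q : Matrix (Fin n) (Fin n) ℝ} {K : Matrix (Fin m) (Fin n) ℝ} {R : Matrix (Fin m) (Fin m) ℝ}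

theorem posSemidef_mul_mul_transpose_add (hQ : Q.PosSemidef) (hR : R.PosSemidef) :
    (B * R * Bᵀ + Q).PosSemidef := by
  have := hR.mul_mul_conjTranspose_same B
  rw [conjTranspose_eq_transpose_of_trivial] at this
  exact this.add hQ

theorem linearPolicy_apply (α : Fin m → ℝ) (x : EuclideanSpace ℝ (Fin n)) :
    linearPolicy K R α x = multivariateGaussian (WithLp.toLp 2 (K *ᵥ x.ofLp + α)) R := rfl

/-- Substituting `u = K x + β` closes the loop: the mean of `B β` joins the drift and its covariance
joins `Q`. -/
theorem stateKernel_linearMDP (hQ : Q.PosSemidef) (hR : R.PosSemidef) (d : Fin n → ℝ)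
    (α : Fin m → ℝ) :
    (linearMDP A B d Q).stateKernel (linearPolicy K R α) =
      gaussianKernel (fun x ↦ WithLp.toLp 2 ((A + B * K) *ᵥ x.ofLp + (B *ᵥ α + d))) (by fun_prop)
        (B * R * Bᵀ + Q) := by
  ext1 x
  have hf : Measurable fun u : EuclideanSpace ℝ (Fin m) ↦
      (WithLp.toLp 2 (A *ᵥ x.ofLp + B *ᵥ u.ofLp + d) : EuclideanSpace ℝ (Fin n)) := by fun_prop
  have h := multivariateGaussian_bind_gaussianKernel (WithLp.toLp 2 (K *ᵥ x.ofLp + α)) hR hQ B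
    (A *ᵥ x.ofLp + d) hf fun u ↦ by simp only []; abel
  rw [MDP.stateKernel, Kernel.comp_apply, Kernel.prod_apply, Kernel.id_apply, Measure.dirac_prod,
    gaussianKernel_apply]
  have h2 : ((linearPolicy K R α x).map (Prod.mk x)).bind (linearMDP A B d Q).trans =
      (linearPolicy K R α x).bind (gaussianKernel _ hf Q) := by
    ext s hs
    rw [Measure.bind_apply hs (Kernel.aemeasurable _), Measure.bind_apply hs (Kernel.aemeasurable _),
      lintegral_map (Kernel.measurable_coe _ hs) measurable_prodMk_left]
    rfl
  rw [h2]
  refine h.trans ?_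
  congr 2
  simp only [mulVec_add, add_mulVec, mulVec_mulVec]
  abel

theorem invariant_stateKernel_linearMDP (hQ : Q.PosSemidef) (hR : R.PosSemidef)
    (hK : (A + B * K).IsSchur) {S : Matrix (Fin n) (Fin n) ℝ} (hS : S.PosSemidef)
    (hlyap : S = (A + B * K) * S * (A + B * K)ᵀ + (B * R * Bᵀ + Q)) (d : Fin n → ℝ)
    (α : Fin m → ℝ) :
    Kernel.Invariant ((linearMDP A B d Q).stateKernel (linearPolicy K R α))
      (multivariateGaussian (WithLp.toLp 2 ((1 - (A + B * K))⁻¹ *ᵥ (B *ᵥ α + d))) S) := by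
  rw [Kernel.Invariant, stateKernel_linearMDP hQ hR,
    multivariateGaussian_bind_gaussianKernel _ hS (posSemidef_mul_mul_transpose_add hQ hR) (A + B * K)
      (B *ᵥ α + d) _ fun _ ↦ rfl, ← hlyap]
  congr 2
  have h : (1 - (A + B * K)) *ᵥ ((1 - (A + B * K))⁻¹ *ᵥ (B *ᵥ α + d)) = B *ᵥ α + d := by
    rw [mulVec_mulVec, mul_nonsing_inv _ hK.isUnit_det_one_sub, one_mulVec]
  rw [sub_mulVec, one_mulVec, sub_eq_iff_eq_add] at h
  simp only []
  rw [add_comm]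
  exact h.symm

theorem isValue_linearMDP (hQ : Q.PosSemidef) (hR : R.PosSemidef) (hK : (A + B * K).IsSchur)
    {S : Matrix (Fin n) (Fin n) ℝ}
    (hlyap : S = (A + B * K) * S * (A + B * K)ᵀ + (B * R * Bᵀ + Q)) (d : Fin n → ℝ)
    (α : Fin m → ℝ) :
    (linearMDP A B d Q).IsValue (linearPolicy K R α)
      (-(((1 - (A + B * K))⁻¹ *ᵥ (B *ᵥ α + d)) ⬝ᵥ ((1 - (A + B * K))⁻¹ *ᵥ (B *ᵥ α + d)) +
        S.trace)) := by
  intro x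
  have hW : (B * R * Bᵀ + Q).PosSemidef := posSemidef_mul_mul_transpose_add hQ hR
  let a : ℕ → Fin n → ℝ := affineIterate (A + B * K) (B *ᵥ α + d) x.ofLp
  let C : ℕ → Matrix (Fin n) (Fin n) ℝ := covarianceIterate (A + B * K) (B * R * Bᵀ + Q)
  have hC : ∀ t, (C t).PosSemidef := posSemidef_covarianceIterate hW
  let μ : ℕ → Measure (EuclideanSpace ℝ (Fin n)) :=
    fun t ↦ multivariateGaussian (WithLp.toLp 2 (a t)) (C t)
  have hstep : ∀ t, (μ t).bind ((linearMDP A B d Q).stateKernel (linearPolicy K R α)) = μ (t + 1) :=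
    fun t ↦ by
      rw [stateKernel_linearMDP hQ hR, multivariateGaussian_bind_gaussianKernel _ (hC t) hW (A + B * K)
        (B *ᵥ α + d) _ fun _ ↦ rfl]
      rfl
  -- A deterministic start is a Gaussian of covariance 0, the initial value of `covarianceIterate`.
  have h0 : Measure.dirac x = μ 0 := dirac_eq_multivariateGaussian x
  have hmap : ∀ t, (markovLaw (Measure.dirac x ⊗ₘ linearPolicy K R α)
      (fun _ ↦ (linearMDP A B d Q).pairKernel (linearPolicy K R α))).map (fun ω ↦ (ω t).1) = μ t :=
    fun t ↦ by
      have h1 := congrArg Measure.fst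
        ((linearMDP A B d Q).markovLaw_map_eval (linearPolicy K R α) μ hstep t)
      rw [Measure.fst_compProd, Measure.fst, Measure.map_map (by fun_prop) (by fun_prop)] at h1
      simp only [h0]
      exact h1
  set P := markovLaw (Measure.dirac x ⊗ₘ linearPolicy K R α)
      (fun _ ↦ (linearMDP A B d Q).pairKernel (linearPolicy K R α)) with hP
  have hint : ∀ t : ℕ, Integrable (fun ω ↦ (linearMDP A B d Q).reward (ω t)) P := fun t ↦ by
    have h1 : Integrable (fun y : EuclideanSpace ℝ (Fin n) ↦ -(y.ofLp ⬝ᵥ y.ofLp)) (μ t) :=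
      (integrable_finsetSum _ fun i _ ↦ integrable_sq_eval_multivariateGaussian _ _ i).neg
    rw [← hmap t] at h1
    exact h1.comp_measurable (measurable_pi_apply t).fst
  have hmean : ∀ t : ℕ, ∫ ω, (linearMDP A B d Q).reward (ω t) ∂P =
      -(a t ⬝ᵥ a t + (C t).trace) := fun t ↦ by
    have h1 := integral_dotProduct_self_multivariateGaussian (WithLp.toLp 2 (a t)) (hC t)
    change ∫ y : EuclideanSpace ℝ (Fin n), y.ofLp ⬝ᵥ y.ofLp ∂(μ t) = _ at h1
    rw [← hmap t, integral_map (measurable_pi_apply t).fst.aemeasurable (by fun_prop)] at h1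
    change ∫ ω, -((ω t).1.ofLp ⬝ᵥ (ω t).1.ofLp) ∂P = _
    rw [integral_neg, h1]
  refine ⟨hint, ?_⟩
  have hlim : Tendsto (fun t ↦ -(a t ⬝ᵥ a t + (C t).trace)) atTop
      (𝓝 (-(((1 - (A + B * K))⁻¹ *ᵥ (B *ᵥ α + d)) ⬝ᵥ ((1 - (A + B * K))⁻¹ *ᵥ (B *ᵥ α + d)) +
        S.trace))) := by
    have ha := hK.tendsto_affineIterate (B *ᵥ α + d) x.ofLp
    have hc1 : Continuous fun v : Fin n → ℝ ↦ v ⬝ᵥ v := continuous_id.dotProduct continuous_id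
    have hc2 : Continuous fun M : Matrix (Fin n) (Fin n) ℝ ↦ M.trace := continuous_id.matrix_trace
    exact (((hc1.tendsto _).comp ha).add
      ((hc2.tendsto _).comp (hK.tendsto_covarianceIterate hlyap))).neg
  refine hlim.cesaro.congr fun N ↦ ?_
  rw [integral_const_mul, integral_finsetSum _ fun t _ ↦ hint t]
  simp_rw [hmean]

theorem pairKernel_linearMDP_apply (d : Fin n → ℝ) (α : Fin m → ℝ)
    (y : EuclideanSpace ℝ (Fin n) × EuclideanSpace ℝ (Fin m)) :
    (linearMDP A B d Q).pairKernel (linearPolicy K R α) y =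
      multivariateGaussian (WithLp.toLp 2 (A *ᵥ y.1.ofLp + B *ᵥ y.2.ofLp + d)) Q ⊗ₘ
        linearPolicy K R α := by
  rw [MDP.pairKernel, Kernel.compProd_apply_eq_compProd_sectR, Kernel.sectR_prodMkLeft]
  rfl

/-- The logarithm of the transition density of `(M₁, π₁)` with respect to `(M₀, π₀)`, when
`Q h₁` and `R h₂` are the changes of the input and of the mean of the policy. -/
noncomputable def linearLogRatio (A : Matrix (Fin n) (Fin n) ℝ) (B : Matrix (Fin n) (Fin m) ℝ)
    (Q : Matrix (Fin n) (Fin n) ℝ) (K : Matrix (Fin m) (Fin n) ℝ) (R : Matrix (Fin m) (Fin m) ℝ)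
    (α₀ : Fin m → ℝ) (h₁ : Fin n → ℝ) (h₂ : Fin m → ℝ)
    (y z : EuclideanSpace ℝ (Fin n) × EuclideanSpace ℝ (Fin m)) : ℝ :=
  (h₁ ⬝ᵥ z.1.ofLp - h₁ ⬝ᵥ (A *ᵥ y.1.ofLp + B *ᵥ y.2.ofLp) - h₁ ⬝ᵥ Q *ᵥ h₁ / 2) +
    (h₂ ⬝ᵥ z.2.ofLp - h₂ ⬝ᵥ (K *ᵥ z.1.ofLp + α₀) - h₂ ⬝ᵥ R *ᵥ h₂ / 2)

theorem measurable_linearLogRatio (α₀ : Fin m → ℝ) (h₁ : Fin n → ℝ) (h₂ : Fin m → ℝ) :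
    Measurable (Function.uncurry (linearLogRatio A B Q K R α₀ h₁ h₂)) := by
  unfold linearLogRatio Function.uncurry
  fun_prop

/-- Cameron-Martin applies to the state factor and to the policy factor, and the densities multiply.
The shifts are written `Q h₁` and `R h₂` to fit that formula. -/
theorem pairKernel_linearMDP_eq_withDensity (hQ : Q.PosSemidef) (hR : R.PosSemidef)
    (α₀ : Fin m → ℝ) (h₁ : Fin n → ℝ) (h₂ : Fin m → ℝ)
    (y : EuclideanSpace ℝ (Fin n) × EuclideanSpace ℝ (Fin m)) :
    (linearMDP A B (Q *ᵥ h₁) Q).pairKernel (linearPolicy K R (α₀ + R *ᵥ h₂)) y =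
      ((linearMDP A B 0 Q).pairKernel (linearPolicy K R α₀) y).withDensity
        (fun z ↦ ENNReal.ofReal (Real.exp (linearLogRatio A B Q K R α₀ h₁ h₂ y z))) := by
  rw [pairKernel_linearMDP_apply, pairKernel_linearMDP_apply, add_zero, WithLp.toLp_add,
    multivariateGaussian_add_eq_withDensity _ hQ]
  have : IsProbabilityMeasure ((multivariateGaussian
      (WithLp.toLp 2 (A *ᵥ y.1.ofLp + B *ᵥ y.2.ofLp)) Q).withDensity (fun x ↦ ENNReal.ofReal
        (Real.exp (h₁ ⬝ᵥ x.ofLp - h₁ ⬝ᵥ (WithLp.toLp 2 (A *ᵥ y.1.ofLp + B *ᵥ y.2.ofLp)).ofLp -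
          h₁ ⬝ᵥ Q *ᵥ h₁ / 2)))) := by
    rw [← multivariateGaussian_add_eq_withDensity _ hQ]
    infer_instance
  rw [withDensity_compProd_withDensity (κ := linearPolicy K R α₀) (by fun_prop)
    (g := fun x u ↦ ENNReal.ofReal (Real.exp
      (h₂ ⬝ᵥ u.ofLp - h₂ ⬝ᵥ (K *ᵥ x.ofLp + α₀) - h₂ ⬝ᵥ R *ᵥ h₂ / 2)))
    (by unfold Function.uncurry; fun_prop)]
  · congr 1
    ext z
    rw [← ENNReal.ofReal_mul (Real.exp_pos _).le, ← Real.exp_add]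
    rfl
  · intro x
    have := multivariateGaussian_add_eq_withDensity (WithLp.toLp 2 (K *ᵥ x.ofLp + α₀)) hR h₂
    rw [← WithLp.toLp_add, add_assoc] at this
    exact this

theorem ae_rnDeriv_pairKernel_linearMDP (hQ : Q.PosSemidef) (hR : R.PosSemidef)
    (α₀ : Fin m → ℝ) (h₁ : Fin n → ℝ) (h₂ : Fin m → ℝ)
    (y : EuclideanSpace ℝ (Fin n) × EuclideanSpace ℝ (Fin m)) :
    ∀ᵐ z ∂((linearMDP A B (Q *ᵥ h₁) Q).pairKernel (linearPolicy K R (α₀ + R *ᵥ h₂)) y),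
      Kernel.rnDeriv ((linearMDP A B (Q *ᵥ h₁) Q).pairKernel (linearPolicy K R (α₀ + R *ᵥ h₂)))
        ((linearMDP A B 0 Q).pairKernel (linearPolicy K R α₀)) y z =
      ENNReal.ofReal (Real.exp (linearLogRatio A B Q K R α₀ h₁ h₂ y z)) := by
  have hg : Measurable (linearLogRatio A B Q K R α₀ h₁ h₂ y) := by
    unfold linearLogRatio; fun_prop
  exact ae_rnDeriv_eq_of_eq_withDensity (g := linearLogRatio A B Q K R α₀ h₁ h₂ y) hg
    (pairKernel_linearMDP_eq_withDensity hQ hR α₀ h₁ h₂ y)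

/-- Under the shifted law, each bracket of `linearLogRatio` is Gaussian with mean half its variance.
The law of the control bracket is free of the new state, so the brackets are independent and means
and variances add; `y` cancels. -/
theorem pairKernel_linearMDP_map_linearLogRatio (hQ : Q.PosSemidef) (hR : R.PosSemidef)
    (α₀ : Fin m → ℝ) (h₁ : Fin n → ℝ) (h₂ : Fin m → ℝ)
    (y : EuclideanSpace ℝ (Fin n) × EuclideanSpace ℝ (Fin m)) :
    ((linearMDP A B (Q *ᵥ h₁) Q).pairKernel (linearPolicy K R (α₀ + R *ᵥ h₂)) y).map
        (linearLogRatio A B Q K R α₀ h₁ h₂ y) =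
      gaussianReal ((h₁ ⬝ᵥ Q *ᵥ h₁ + h₂ ⬝ᵥ R *ᵥ h₂) / 2)
        (2 * ((h₁ ⬝ᵥ Q *ᵥ h₁ + h₂ ⬝ᵥ R *ᵥ h₂) / 2)).toNNReal := by
  have hv₁ : 0 ≤ h₁ ⬝ᵥ Q *ᵥ h₁ := by simpa using hQ.dotProduct_mulVec_nonneg h₁
  have hv₂ : 0 ≤ h₂ ⬝ᵥ R *ᵥ h₂ := by simpa using hR.dotProduct_mulVec_nonneg h₂
  rw [pairKernel_linearMDP_apply]
  have hκ : ∀ x, (linearPolicy K R (α₀ + R *ᵥ h₂) x).map (fun u ↦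
      h₂ ⬝ᵥ u.ofLp - h₂ ⬝ᵥ (K *ᵥ x.ofLp + α₀) - h₂ ⬝ᵥ R *ᵥ h₂ / 2) =
      gaussianReal (h₂ ⬝ᵥ R *ᵥ h₂ / 2) (h₂ ⬝ᵥ R *ᵥ h₂).toNNReal := fun x ↦ by
    have h := multivariateGaussian_map_dotProduct_add
      (WithLp.toLp 2 (K *ᵥ x.ofLp + (α₀ + R *ᵥ h₂))) hR h₂
      (-(h₂ ⬝ᵥ (K *ᵥ x.ofLp + α₀)) - h₂ ⬝ᵥ R *ᵥ h₂ / 2)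
    rw [linearPolicy_apply]
    convert h using 2
    · ext u; ring
    · simp only [dotProduct_add]; ring
  have hμ : (multivariateGaussian
      (WithLp.toLp 2 (A *ᵥ y.1.ofLp + B *ᵥ y.2.ofLp + Q *ᵥ h₁)) Q).map (fun x ↦
        h₁ ⬝ᵥ x.ofLp - h₁ ⬝ᵥ (A *ᵥ y.1.ofLp + B *ᵥ y.2.ofLp) - h₁ ⬝ᵥ Q *ᵥ h₁ / 2) =
      gaussianReal (h₁ ⬝ᵥ Q *ᵥ h₁ / 2) (h₁ ⬝ᵥ Q *ᵥ h₁).toNNReal := by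
    have h := multivariateGaussian_map_dotProduct_add
      (WithLp.toLp 2 (A *ᵥ y.1.ofLp + B *ᵥ y.2.ofLp + Q *ᵥ h₁)) hQ h₁
      (-(h₁ ⬝ᵥ (A *ᵥ y.1.ofLp + B *ᵥ y.2.ofLp)) - h₁ ⬝ᵥ Q *ᵥ h₁ / 2)
    convert h using 2
    · ext u; ring
    · simp only [dotProduct_add]; ring
  have h := map_add_compProd_of_map_eq (μ := multivariateGaussian
      (WithLp.toLp 2 (A *ᵥ y.1.ofLp + B *ᵥ y.2.ofLp + Q *ᵥ h₁)) Q) (f := fun x ↦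
        h₁ ⬝ᵥ x.ofLp - h₁ ⬝ᵥ (A *ᵥ y.1.ofLp + B *ᵥ y.2.ofLp) - h₁ ⬝ᵥ Q *ᵥ h₁ / 2)
      (by fun_prop) (by unfold Function.uncurry; fun_prop) hκ
  rw [hμ, gaussianReal_conv_gaussianReal, ← Real.toNNReal_add hv₁ hv₂, ← add_div] at h
  rw [mul_div_cancel₀ _ two_ne_zero]
  exact h

theorem isFullInformationRate_linear (hQ : Q.PosSemidef) (hR : R.PosSemidef)
    (hK : (A + B * K).IsSchur) {S : Matrix (Fin n) (Fin n) ℝ} (hS : S.PosSemidef)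
    (hlyap : S = (A + B * K) * S * (A + B * K)ᵀ + (B * R * Bᵀ + Q))
    (α₀ : Fin m → ℝ) (h₁ : Fin n → ℝ) (h₂ : Fin m → ℝ) :
    IsFullInformationRate (linearMDP A B 0 Q) (linearMDP A B (Q *ᵥ h₁) Q) (linearPolicy K R α₀)
      (linearPolicy K R (α₀ + R *ᵥ h₂)) ((h₁ ⬝ᵥ Q *ᵥ h₁ + h₂ ⬝ᵥ R *ᵥ h₂) / 2) := by
  have hv₁ : 0 ≤ h₁ ⬝ᵥ Q *ᵥ h₁ := by simpa using hQ.dotProduct_mulVec_nonneg h₁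
  have hv₂ : 0 ≤ h₂ ⬝ᵥ R *ᵥ h₂ := by simpa using hR.dotProduct_mulVec_nonneg h₂
  exact ⟨⟨_, inferInstance, invariant_stateKernel_linearMDP hQ hR hK hS hlyap 0 α₀⟩, fun μ _ _ ↦
    isInformationRate_of_map_eq_gaussianReal (measurable_linearLogRatio α₀ h₁ h₂)
      (ae_rnDeriv_pairKernel_linearMDP hQ hR α₀ h₁ h₂) (by positivity)
      (pairKernel_linearMDP_map_linearLogRatio hQ hR α₀ h₁ h₂)⟩

end LinearSystems

/-! ### Minimizing the quadratic loss -/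

section QuadraticForms

variable {n m : ℕ}

theorem Matrix.PosDef.eq_zero_of_dotProduct_mulVec_nonpos {M : Matrix (Fin n) (Fin n) ℝ}
    (hM : M.PosDef) {x : Fin n → ℝ} (hx : x ⬝ᵥ M *ᵥ x ≤ 0) : x = 0 := by
  by_contra h
  have := hM.dotProduct_mulVec_pos h
  rw [star_trivial] at this
  linarith

theorem Matrix.PosDef.dotProduct_mulVec_self_nonneg {M : Matrix (Fin n) (Fin n) ℝ}
    (hM : M.PosDef) (x : Fin n → ℝ) : 0 ≤ x ⬝ᵥ M *ᵥ x := by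
  simpa using hM.posSemidef.dotProduct_mulVec_nonneg x

theorem Matrix.PosDef.transpose_eq {M : Matrix (Fin n) (Fin n) ℝ} (hM : M.PosDef) : Mᵀ = M := by
  simpa [conjTranspose_eq_transpose_of_trivial] using hM.isHermitian.eq

theorem Matrix.PosDef.dotProduct_mulVec_comm {M : Matrix (Fin n) (Fin n) ℝ} (hM : M.PosDef)
    (x y : Fin n → ℝ) : x ⬝ᵥ M *ᵥ y = y ⬝ᵥ M *ᵥ x := by
  rw [dotProduct_mulVec, ← mulVec_transpose, hM.transpose_eq, dotProduct_comm]

theorem Matrix.PosDef.dotProduct_mulVec_add_self {M : Matrix (Fin n) (Fin n) ℝ} (hM : M.PosDef)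
    (x h : Fin n → ℝ) :
    (x + h) ⬝ᵥ M *ᵥ (x + h) = x ⬝ᵥ M *ᵥ x + 2 * (h ⬝ᵥ M *ᵥ x) + h ⬝ᵥ M *ᵥ h := by
  rw [mulVec_add, add_dotProduct, dotProduct_add, dotProduct_add, hM.dotProduct_mulVec_comm x h]
  ring

theorem dotProduct_transpose_mul_mul_mulVec (M : Matrix (Fin n) (Fin n) ℝ)
    (B : Matrix (Fin n) (Fin m) ℝ) (x y : Fin m → ℝ) :
    x ⬝ᵥ (Bᵀ * M * B) *ᵥ y = (B *ᵥ x) ⬝ᵥ M *ᵥ (B *ᵥ y) := by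
  rw [Matrix.mul_assoc, ← mulVec_mulVec, ← mulVec_mulVec, dotProduct_mulVec, vecMul_transpose]

theorem Matrix.PosDef.transpose_mul_mul {M : Matrix (Fin n) (Fin n) ℝ} (hM : M.PosDef)
    {B : Matrix (Fin n) (Fin m) ℝ} (hB : LinearIndependent ℝ B.col) : (Bᵀ * M * B).PosDef := by
  have := hM.conjTranspose_mul_mul_same (mulVec_injective_iff.2 hB)
  rwa [conjTranspose_eq_transpose_of_trivial] at this

theorem posDef_transpose_inv_mul_inv {L : Matrix (Fin n) (Fin n) ℝ} (hL : IsUnit L.det) :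
    ((L⁻¹)ᵀ * L⁻¹).PosDef := by
  have h : Function.Injective (L⁻¹).mulVec := by
    rw [mulVec_injective_iff_isUnit]
    exact (isUnit_nonsing_inv_iff).2 ((isUnit_iff_isUnit_det _).2 hL)
  have := PosDef.conjTranspose_mul_self _ h
  rwa [conjTranspose_eq_transpose_of_trivial] at this

/-- A loss whose excess over a point is a positive definite function of the displacement is minimal
at that point only. -/
theorem forall_le_iff_eq_of_sub_eq {V : Type*} [AddCommGroup V] {f q : V → ℝ} {x₀ : V}
    (hf : ∀ x, f x = f x₀ - q (x - x₀)) (hq : ∀ h, 0 ≤ q h) (hq0 : ∀ h, q h ≤ 0 → h = 0) (x : V) :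
    (∀ y, f y ≤ f x) ↔ x = x₀ := by
  constructor
  · intro h
    have h1 := h x₀
    rw [hf x] at h1
    exact sub_eq_zero.1 (hq0 _ (by linarith))
  · rintro rfl y
    rw [hf y]
    linarith [hq (y - x)]

variable {E : Matrix (Fin n) (Fin n) ℝ} {B : Matrix (Fin n) (Fin m) ℝ}
  {R : Matrix (Fin m) (Fin m) ℝ}

/-- The part of the utility-privacy function which depends on the means of the policies. -/
noncomputable def quadraticLoss (E : Matrix (Fin n) (Fin n) ℝ) (B : Matrix (Fin n) (Fin m) ℝ)
    (R : Matrix (Fin m) (Fin m) ℝ) (f : Fin n → ℝ) (ρ lam : ℝ) (α₀ α₁ : Fin m → ℝ) : ℝ :=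
  (1 - ρ) * (α₀ ⬝ᵥ (Bᵀ * E * B) *ᵥ α₀) + ρ * ((B *ᵥ α₁ + f) ⬝ᵥ E *ᵥ (B *ᵥ α₁ + f)) +
    lam / 2 * ((α₁ - α₀) ⬝ᵥ R⁻¹ *ᵥ (α₁ - α₀))

/-- Exact second-order expansion; the vectors paired with `h₀` and `h₁` are half the partial
gradients. -/
theorem quadraticLoss_add (hE : E.PosDef) (hB : LinearIndependent ℝ B.col) (hR : R.PosDef)
    (f : Fin n → ℝ) {ρ lam : ℝ} {α₀ α₁ : Fin m → ℝ} (h₀ h₁ : Fin m → ℝ) :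
    quadraticLoss E B R f ρ lam (α₀ + h₀) (α₁ + h₁) = quadraticLoss E B R f ρ lam α₀ α₁ +
      2 * (h₀ ⬝ᵥ ((1 - ρ) • ((Bᵀ * E * B) *ᵥ α₀) - (lam / 2) • (R⁻¹ *ᵥ (α₁ - α₀)))) +
      2 * (h₁ ⬝ᵥ (ρ • ((Bᵀ * E * B) *ᵥ α₁ + Bᵀ *ᵥ (E *ᵥ f)) +
        (lam / 2) • (R⁻¹ *ᵥ (α₁ - α₀)))) +
      ((1 - ρ) * (h₀ ⬝ᵥ (Bᵀ * E * B) *ᵥ h₀) + ρ * (h₁ ⬝ᵥ (Bᵀ * E * B) *ᵥ h₁) +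
        lam / 2 * ((h₁ - h₀) ⬝ᵥ R⁻¹ *ᵥ (h₁ - h₀))) := by
  have e1 : B *ᵥ (α₁ + h₁) + f = (B *ᵥ α₁ + f) + B *ᵥ h₁ := by rw [mulVec_add]; abel
  have e2 : (α₁ + h₁) - (α₀ + h₀) = (α₁ - α₀) + (h₁ - h₀) := by abel
  have e3 : (B *ᵥ h₁) ⬝ᵥ E *ᵥ (B *ᵥ α₁ + f) =
      h₁ ⬝ᵥ ((Bᵀ * E * B) *ᵥ α₁ + Bᵀ *ᵥ (E *ᵥ f)) := by
    rw [mulVec_add, dotProduct_add, dotProduct_add, dotProduct_transpose_mul_mul_mulVec,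
      dotProduct_mulVec h₁ Bᵀ, vecMul_transpose]
  rw [quadraticLoss, quadraticLoss, e1, e2, (hE.transpose_mul_mul hB).dotProduct_mulVec_add_self,
    hE.dotProduct_mulVec_add_self, hR.inv.dotProduct_mulVec_add_self, e3,
    ← dotProduct_transpose_mul_mul_mulVec, sub_dotProduct h₁ h₀ (R⁻¹ *ᵥ (α₁ - α₀))]
  simp only [dotProduct_add h₁, dotProduct_sub h₀, dotProduct_smul, smul_eq_mul]
  ring

/-- The hypotheses `h0` and `h1` say that both partial gradients vanish at `(β₀, β₁)`. If the
second-order part vanishes, its `lam` term forces equal displacements; the weights `1 - ρ` and `ρ`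
then add up to 1 on one definite form. So the endpoints `ρ = 0, 1` need no separate treatment. -/
theorem forall_quadraticLoss_le_iff (hE : E.PosDef) (hB : LinearIndependent ℝ B.col)
    (hR : R.PosDef) (f : Fin n → ℝ) {ρ lam : ℝ} (hρ : ρ ∈ Set.Icc (0 : ℝ) 1) (hlam : 0 < lam)
    {β₀ β₁ : Fin m → ℝ}
    (h0 : (1 - ρ) • ((Bᵀ * E * B) *ᵥ β₀) = (lam / 2) • (R⁻¹ *ᵥ (β₁ - β₀)))
    (h1 : ρ • ((Bᵀ * E * B) *ᵥ β₁ + Bᵀ *ᵥ (E *ᵥ f)) = -((lam / 2) • (R⁻¹ *ᵥ (β₁ - β₀))))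
    (α₀ α₁ : Fin m → ℝ) :
    (∀ a₀ a₁, quadraticLoss E B R f ρ lam α₀ α₁ ≤ quadraticLoss E B R f ρ lam a₀ a₁) ↔
      α₀ = β₀ ∧ α₁ = β₁ := by
  have hG := hE.transpose_mul_mul hB
  have hρ0 : 0 ≤ ρ := hρ.1
  have hρ1 : 0 ≤ 1 - ρ := sub_nonneg.2 hρ.2
  have key := forall_le_iff_eq_of_sub_eq (V := (Fin m → ℝ) × (Fin m → ℝ))
    (f := fun a ↦ -quadraticLoss E B R f ρ lam a.1 a.2)
    (q := fun h ↦ (1 - ρ) * (h.1 ⬝ᵥ (Bᵀ * E * B) *ᵥ h.1) + ρ * (h.2 ⬝ᵥ (Bᵀ * E * B) *ᵥ h.2) +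
        lam / 2 * ((h.2 - h.1) ⬝ᵥ R⁻¹ *ᵥ (h.2 - h.1))) (x₀ := (β₀, β₁)) ?_ ?_ ?_ (α₀, α₁)
  · rw [Prod.mk.injEq] at key
    rw [← key]
    simp
  · rintro ⟨a₀, a₁⟩
    have h := quadraticLoss_add hE hB hR f (ρ := ρ) (lam := lam) (α₀ := β₀) (α₁ := β₁)
      (a₀ - β₀) (a₁ - β₁)
    rw [h0, h1, sub_self, neg_add_cancel, dotProduct_zero, dotProduct_zero, add_sub_cancel,
      add_sub_cancel] at h
    simp only [Prod.fst_sub, Prod.snd_sub, h]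
    ring
  · rintro ⟨h₀, h₁⟩
    have := hG.dotProduct_mulVec_self_nonneg h₀
    have := hG.dotProduct_mulVec_self_nonneg h₁
    have := hR.inv.dotProduct_mulVec_self_nonneg (h₁ - h₀)
    positivity
  · rintro ⟨h₀, h₁⟩ h
    simp only at h
    have n0 := mul_nonneg hρ1 (hG.dotProduct_mulVec_self_nonneg h₀)
    have n1 := mul_nonneg hρ0 (hG.dotProduct_mulVec_self_nonneg h₁)
    have n2 := hR.inv.dotProduct_mulVec_self_nonneg (h₁ - h₀)
    have e1 : h₁ - h₀ = 0 := hR.inv.eq_zero_of_dotProduct_mulVec_nonpos (by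
      by_contra! hc
      have : 0 < lam / 2 * ((h₁ - h₀) ⬝ᵥ R⁻¹ *ᵥ (h₁ - h₀)) := by positivity
      linarith)
    obtain rfl : h₁ = h₀ := sub_eq_zero.1 e1
    have e2 : h₁ = 0 := hG.eq_zero_of_dotProduct_mulVec_nonpos (by
      rw [sub_self, zero_dotProduct, mul_zero] at h
      linarith)
    rw [e2]; rfl

/-- With the first mean frozen at 0, only the gradient in the second mean has to vanish. -/
theorem forall_quadraticLoss_one_zero_le_iff (hE : E.PosDef) (hB : LinearIndependent ℝ B.col)
    (hR : R.PosDef) (f : Fin n → ℝ) {lam : ℝ} (hlam : 0 < lam) {β : Fin m → ℝ}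
    (h1 : (Bᵀ * E * B) *ᵥ β + Bᵀ *ᵥ (E *ᵥ f) = -((lam / 2) • (R⁻¹ *ᵥ β))) (α : Fin m → ℝ) :
    (∀ a, quadraticLoss E B R f 1 lam 0 α ≤ quadraticLoss E B R f 1 lam 0 a) ↔ α = β := by
  have hG := hE.transpose_mul_mul hB
  rw [← forall_le_iff_eq_of_sub_eq (f := fun a ↦ -quadraticLoss E B R f 1 lam 0 a)
    (q := fun h ↦ h ⬝ᵥ (Bᵀ * E * B) *ᵥ h + lam / 2 * (h ⬝ᵥ R⁻¹ *ᵥ h)) (x₀ := β) ?_ ?_ ?_ α]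
  · simp
  · intro a
    have h := quadraticLoss_add hE hB hR f (ρ := 1) (lam := lam) (α₀ := 0) (α₁ := β) 0 (a - β)
    rw [one_smul, h1, sub_zero, neg_add_cancel, dotProduct_zero, add_sub_cancel] at h
    simp only [add_zero, sub_zero, zero_dotProduct] at h
    rw [h]
    ring
  · intro h
    have := hG.dotProduct_mulVec_self_nonneg h
    have := hR.inv.dotProduct_mulVec_self_nonneg h
    positivity
  · intro h hh
    have n2 := mul_nonneg (half_pos hlam).le (hR.inv.dotProduct_mulVec_self_nonneg h)
    exact hG.eq_zero_of_dotProduct_mulVec_nonpos (by linarith)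

end QuadraticForms
-- The utility-privacy function in closed form
section UtilityPrivacy

variable {n m k : ℕ} {A : Matrix (Fin n) (Fin n) ℝ} {B : Matrix (Fin n) (Fin m) ℝ}
  {F : Matrix (Fin n) (Fin k) ℝ} {θ : Fin k → ℝ}
  {Q : Matrix (Fin n) (Fin n) ℝ} {K : Matrix (Fin m) (Fin n) ℝ} {R : Matrix (Fin m) (Fin m) ℝ}

theorem isLinearUtilityPrivacyValue_quadraticLoss (hQ : Q.PosDef) (hR : R.PosDef)
    (hK : (A + B * K).IsSchur) {S : Matrix (Fin n) (Fin n) ℝ} (hS : S.PosSemidef)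
    (hlyap : S = (A + B * K) * S * (A + B * K)ᵀ + (B * R * Bᵀ + Q)) (ρ lam : ℝ)
    (α₀ α₁ : Fin m → ℝ) :
    IsLinearUtilityPrivacyValue A B F θ Q K R ρ lam α₀ α₁
      (-S.trace - lam * ((F *ᵥ θ) ⬝ᵥ Q⁻¹ *ᵥ (F *ᵥ θ) / 2) -
        quadraticLoss (((1 - (A + B * K))⁻¹)ᵀ * (1 - (A + B * K))⁻¹) B R (F *ᵥ θ) ρ lam α₀ α₁) := by
  -- These choices make the shifts `Q h₁ = F θ` and `R h₂ = α₁ - α₀`.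
  have hI := isFullInformationRate_linear hQ.posSemidef hR.posSemidef hK hS hlyap α₀
    (Q⁻¹ *ᵥ (F *ᵥ θ)) (R⁻¹ *ᵥ (α₁ - α₀))
  rw [mulVec_mulVec, mul_nonsing_inv _ ((isUnit_iff_isUnit_det _).1 hQ.isUnit), one_mulVec,
    mulVec_mulVec, mul_nonsing_inv _ ((isUnit_iff_isUnit_det _).1 hR.isUnit), one_mulVec,
    add_sub_cancel, dotProduct_comm _ (F *ᵥ θ), dotProduct_comm _ (α₁ - α₀)] at hI
  have hE : ∀ b : Fin n → ℝ, ((1 - (A + B * K))⁻¹ *ᵥ b) ⬝ᵥ ((1 - (A + B * K))⁻¹ *ᵥ b) =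
      b ⬝ᵥ (((1 - (A + B * K))⁻¹)ᵀ * (1 - (A + B * K))⁻¹) *ᵥ b := fun b ↦ by
    have h := dotProduct_transpose_mul_mul_mulVec 1 ((1 - (A + B * K))⁻¹) b b
    rw [Matrix.mul_one, one_mulVec] at h
    exact h.symm
  refine ⟨_, _, _, isValue_linearMDP hQ.posSemidef hR.posSemidef hK hlyap 0 α₀,
    isValue_linearMDP hQ.posSemidef hR.posSemidef hK hlyap (F *ᵥ θ) α₁, hI, ?_⟩
  rw [hE, hE, add_zero, quadraticLoss, dotProduct_transpose_mul_mul_mulVec]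
  ring

/-- Existence makes the `Classical.epsilon` choice a genuine value; uniqueness makes it the only
one. -/
theorem isLinearUtilityPrivacyValue_iff_eq_linearVF {ρ lam : ℝ} {α₀ α₁ : Fin m → ℝ} {v : ℝ}
    (hv : IsLinearUtilityPrivacyValue A B F θ Q K R ρ lam α₀ α₁ v) (w : ℝ) :
    IsLinearUtilityPrivacyValue A B F θ Q K R ρ lam α₀ α₁ w ↔
      w = linearVF A B F θ Q K R ρ lam α₀ α₁ := by
  have hspec : IsLinearUtilityPrivacyValue A B F θ Q K R ρ lam α₀ α₁
      (linearVF A B F θ Q K R ρ lam α₀ α₁) := Classical.epsilon_spec ⟨v, hv⟩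
  exact ⟨fun h ↦ IsUtilityPrivacyValue.unique h hspec, fun h ↦ h ▸ hspec⟩

end UtilityPrivacy

/-! ### Solving the critical-point equations -/

theorem proposition3 {n m k : ℕ} (A : Matrix (Fin n) (Fin n) ℝ) (B : Matrix (Fin n) (Fin m) ℝ)
    (F : Matrix (Fin n) (Fin k) ℝ) (θ : Fin k → ℝ) (Q : Matrix (Fin n) (Fin n) ℝ)
    (K : Matrix (Fin m) (Fin n) ℝ) (R : Matrix (Fin m) (Fin m) ℝ)
    (hQ : Q.PosDef) (hR : R.PosDef) (hB : LinearIndependent ℝ B.col) (hK : (A + B * K).IsSchur)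
    (L E : Matrix (Fin n) (Fin n) ℝ) (hL : L = 1 - A - B * K) (hE : E = (L⁻¹)ᵀ * L⁻¹)
    (T : ℝ → ℝ → Matrix (Fin n) (Fin n) ℝ)
    (hT : ∀ ρ lam, T ρ lam = (1 + (2 * (1 - ρ) * ρ / lam) • (E * B * R * Bᵀ)) * E)
    (α₀s α₁s : ℝ → ℝ → Fin m → ℝ)
    (hα₀s : ∀ ρ lam, α₀s ρ lam = -(ρ • ((Bᵀ * T ρ lam * B)⁻¹ *ᵥ (Bᵀ *ᵥ (E *ᵥ (F *ᵥ θ))))))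
    (hα₁s : ∀ ρ lam, α₁s ρ lam = ((2 * ((1 - ρ) / lam)) • (R * Bᵀ * E * B) + 1) *ᵥ α₀s ρ lam) :
    IsUnit L.det ∧
    -- the Lyapunov equation has exactly one solution, and it is positive definite
    ∃ S : Matrix (Fin n) (Fin n) ℝ,
      (S.PosDef ∧ S = (A + B * K) * S * (A + B * K)ᵀ + Q + B * R * Bᵀ ∧
        ∀ S' : Matrix (Fin n) (Fin n) ℝ,
          S' = (A + B * K) * S' * (A + B * K)ᵀ + Q + B * R * Bᵀ → S' = S) ∧
      -- the utility-privacy function is well defined and has the stated form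
      (∀ ρ ∈ Set.Icc (0 : ℝ) 1, ∀ lam : ℝ, 0 ≤ lam → ∀ α₀ α₁ : Fin m → ℝ,
        (∀ v : ℝ, IsLinearUtilityPrivacyValue A B F θ Q K R ρ lam α₀ α₁ v ↔
          v = linearVF A B F θ Q K R ρ lam α₀ α₁) ∧
        linearVF A B F θ Q K R ρ lam α₀ α₁ =
          -((1 - ρ) * (α₀ ⬝ᵥ (Bᵀ * E * B) *ᵥ α₀)) - S.trace
            - ρ * ((B *ᵥ α₁ + F *ᵥ θ) ⬝ᵥ E *ᵥ (B *ᵥ α₁ + F *ᵥ θ))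
            - lam * (((F *ᵥ θ) ⬝ᵥ Q⁻¹ *ᵥ (F *ᵥ θ) + (α₁ - α₀) ⬝ᵥ R⁻¹ *ᵥ (α₁ - α₀)) / 2)) ∧
      -- its maximizers over both means
      (∀ ρ ∈ Set.Icc (0 : ℝ) 1, ∀ lam : ℝ, 0 < lam →
        IsUnit (Bᵀ * T ρ lam * B).det ∧
        ∀ α₀ α₁ : Fin m → ℝ,
          (∀ a₀ a₁ : Fin m → ℝ, linearVF A B F θ Q K R ρ lam a₀ a₁ ≤
            linearVF A B F θ Q K R ρ lam α₀ α₁) ↔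
          (α₀ = α₀s ρ lam ∧ α₁ = α₁s ρ lam)) ∧
      -- its maximizer over the second mean when `ρ = 1` and the first mean is zero
      (∀ lam : ℝ, 0 < lam →
        IsUnit (R * Bᵀ * E * B + (lam / 2) • (1 : Matrix (Fin m) (Fin m) ℝ)).det ∧
        ∀ α₁ : Fin m → ℝ,
          (∀ a₁ : Fin m → ℝ, linearVF A B F θ Q K R 1 lam 0 a₁ ≤
            linearVF A B F θ Q K R 1 lam 0 α₁) ↔
          α₁ = -((R * Bᵀ * E * B + (lam / 2) • (1 : Matrix (Fin m) (Fin m) ℝ))⁻¹ *ᵥ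
            (R *ᵥ (Bᵀ *ᵥ (E *ᵥ (F *ᵥ θ)))))) := by

  have hLN : L = 1 - (A + B * K) := by rw [hL, sub_sub]
  have hLdet : IsUnit L.det := hLN ▸ hK.isUnit_det_one_sub
  have hEpd : E.PosDef := hE ▸ posDef_transpose_inv_mul_inv hLdet
  have hG : (Bᵀ * E * B).PosDef := hEpd.transpose_mul_mul hB
  have hRR : R * R⁻¹ = 1 := mul_nonsing_inv _ ((isUnit_iff_isUnit_det _).1 hR.isUnit)
  have hRR' : R⁻¹ * R = 1 := nonsing_inv_mul _ ((isUnit_iff_isUnit_det _).1 hR.isUnit)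
  have hW : (B * R * Bᵀ + Q).PosDef := by
    have := hR.posSemidef.mul_mul_conjTranspose_same B
    rw [conjTranspose_eq_transpose_of_trivial] at this
    exact PosDef.posSemidef_add this hQ
  obtain ⟨S, hS, hlyap, huniq⟩ := hK.exists_lyapunov hW
  have hQW : ∀ X : Matrix (Fin n) (Fin n) ℝ,
      X + Q + B * R * Bᵀ = X + (B * R * Bᵀ + Q) := fun X ↦ by abel
  have hval : ∀ ρ lam α₀ α₁, IsLinearUtilityPrivacyValue A B F θ Q K R ρ lam α₀ α₁
      (-S.trace - lam * ((F *ᵥ θ) ⬝ᵥ Q⁻¹ *ᵥ (F *ᵥ θ) / 2) -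
        quadraticLoss E B R (F *ᵥ θ) ρ lam α₀ α₁) := fun ρ lam α₀ α₁ ↦ by
    rw [hE, hLN]
    exact isLinearUtilityPrivacyValue_quadraticLoss hQ hR hK hS.posSemidef hlyap ρ lam α₀ α₁
  have hVF : ∀ ρ lam α₀ α₁, linearVF A B F θ Q K R ρ lam α₀ α₁ =
      -S.trace - lam * ((F *ᵥ θ) ⬝ᵥ Q⁻¹ *ᵥ (F *ᵥ θ) / 2) -
        quadraticLoss E B R (F *ᵥ θ) ρ lam α₀ α₁ := fun ρ lam α₀ α₁ ↦
    ((isLinearUtilityPrivacyValue_iff_eq_linearVF (hval ρ lam α₀ α₁) _).1 (hval ρ lam α₀ α₁)).symm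
  refine ⟨hLdet, S, ⟨hS, by rw [hQW]; exact hlyap, fun S' hS' ↦ huniq S' (by rwa [hQW] at hS')⟩,
    fun ρ _ lam _ α₀ α₁ ↦ ⟨isLinearUtilityPrivacyValue_iff_eq_linearVF (hval ρ lam α₀ α₁), ?_⟩,
    fun ρ hρ lam hlam ↦ ?_, fun lam hlam ↦ ?_⟩
  · rw [hVF, quadraticLoss]
    ring
  · have hρ0 : 0 ≤ ρ := hρ.1
    have hρ1 : 0 ≤ 1 - ρ := sub_nonneg.2 hρ.2
    -- With `G = Bᵀ E B` this reads `G + c G R G` with `c ≥ 0`: definite plus semidefinite.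
    have hBTB : Bᵀ * T ρ lam * B =
        Bᵀ * E * B + (2 * (1 - ρ) * ρ / lam) • ((Bᵀ * E * B) * R * (Bᵀ * E * B)) := by
      rw [hT, add_mul, Matrix.one_mul, Matrix.mul_add, Matrix.add_mul, Matrix.smul_mul,
        Matrix.mul_smul, Matrix.smul_mul]
      simp only [Matrix.mul_assoc]
    have hpd : (Bᵀ * T ρ lam * B).PosDef := by
      rw [hBTB]
      have h1 := hR.posSemidef.mul_mul_conjTranspose_same (Bᵀ * E * B)
      rw [conjTranspose_eq_transpose_of_trivial, hG.transpose_eq] at h1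
      exact hG.add_posSemidef (h1.smul (by positivity))
    have hdet : IsUnit (Bᵀ * T ρ lam * B).det := (isUnit_iff_isUnit_det _).1 hpd.isUnit
    refine ⟨hdet, fun α₀ α₁ ↦ ?_⟩
    -- Vanishing gradient in `α₀`; it is what dictates the formula for `α₁s`.
    have hdiff : (lam / 2) • (R⁻¹ *ᵥ (α₁s ρ lam - α₀s ρ lam)) =
        (1 - ρ) • ((Bᵀ * E * B) *ᵥ α₀s ρ lam) := by
      rw [hα₁s, add_mulVec, one_mulVec, add_sub_cancel_right, smul_mulVec, mulVec_smul,
        mulVec_mulVec, smul_smul, Matrix.mul_assoc R, Matrix.mul_assoc R, ← Matrix.mul_assoc R⁻¹,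
        hRR', Matrix.one_mul]
      congr 1
      field_simp
    -- This is what remains of the gradient equation in `α₁` once `α₁s` is eliminated through
    -- `hdiff`.
    have hcrit : ρ • (Bᵀ *ᵥ (E *ᵥ (F *ᵥ θ))) = -((Bᵀ * T ρ lam * B) *ᵥ α₀s ρ lam) := by
      rw [hα₀s, mulVec_neg, mulVec_smul, mulVec_mulVec _ _ ((Bᵀ * T ρ lam * B)⁻¹),
        mul_nonsing_inv _ hdet, one_mulVec, neg_neg]
    have hGα : ρ • ((Bᵀ * E * B) *ᵥ α₁s ρ lam) = ρ • ((Bᵀ * E * B) *ᵥ α₀s ρ lam) +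
        (2 * (1 - ρ) * ρ / lam) • (((Bᵀ * E * B) * R * (Bᵀ * E * B)) *ᵥ α₀s ρ lam) := by
      rw [hα₁s, add_mulVec, one_mulVec, mulVec_add, smul_add, add_comm, smul_mulVec, mulVec_smul,
        mulVec_mulVec, smul_smul]
      simp only [Matrix.mul_assoc]
      congr 2
      ring
    rw [← forall_quadraticLoss_le_iff hEpd hB hR (F *ᵥ θ) hρ hlam hdiff.symm ?_ α₀ α₁]
    · simp only [hVF, sub_le_sub_iff_left]
    · rw [hdiff, smul_add, hGα, hcrit, hBTB, add_mulVec, smul_mulVec, sub_smul, one_smul]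
      abel
  -- The matrix need not be symmetric; factoring out `R` leaves a positive definite one.
  · have hfac : R * Bᵀ * E * B + (lam / 2) • (1 : Matrix (Fin m) (Fin m) ℝ) =
        R * (Bᵀ * E * B + (lam / 2) • R⁻¹) := by
      rw [Matrix.mul_add, Matrix.mul_smul, hRR]
      simp only [Matrix.mul_assoc]
    have hpd : (Bᵀ * E * B + (lam / 2) • R⁻¹).PosDef := hG.add (hR.inv.smul (half_pos hlam))
    have hdet : IsUnit (R * Bᵀ * E * B + (lam / 2) • (1 : Matrix (Fin m) (Fin m) ℝ)).det := by
      rw [hfac, det_mul]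
      exact ((isUnit_iff_isUnit_det _).1 hR.isUnit).mul ((isUnit_iff_isUnit_det _).1 hpd.isUnit)
    refine ⟨hdet, fun α₁ ↦ ?_⟩
    rw [← forall_quadraticLoss_one_zero_le_iff hEpd hB hR (F *ᵥ θ) hlam ?_ α₁]
    · simp only [hVF, sub_le_sub_iff_left]
    · set β := -((R * Bᵀ * E * B + (lam / 2) • (1 : Matrix (Fin m) (Fin m) ℝ))⁻¹ *ᵥ
            (R *ᵥ (Bᵀ *ᵥ (E *ᵥ (F *ᵥ θ))))) with hβ
      have h1 : (R * Bᵀ * E * B + (lam / 2) • (1 : Matrix (Fin m) (Fin m) ℝ)) *ᵥ β =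
          -(R *ᵥ (Bᵀ *ᵥ (E *ᵥ (F *ᵥ θ)))) := by
        rw [hβ, mulVec_neg, mulVec_mulVec _ _ ((R * Bᵀ * E * B + (lam / 2) • 1)⁻¹),
          mul_nonsing_inv _ hdet, one_mulVec]
      -- Multiplication by `R⁻¹` turns the formula for `β` into the gradient equation.
      have h2 := congrArg R⁻¹.mulVec h1
      clear_value β
      rw [hfac, mulVec_neg, mulVec_mulVec β, mulVec_mulVec _ R⁻¹ R, ← Matrix.mul_assoc R⁻¹, hRR',
        Matrix.one_mul, one_mulVec, add_mulVec, smul_mulVec] at h2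
      rw [← neg_eq_iff_eq_neg.2 h2]
      abel
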